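/- Let $c(x,y)=(x_1-y_1)(x_2-y_2)$ for $x,y\in\mathbb R^2$, and let $Y=(Y_1,Y_2)$ be a square-integrable random variable on a probability space $(\Omega,\mathcal F,\mathbb P)$ with law $\nu$. Let $\Gamma(\nu)$ be the set of Borel probability measures $\gamma(dx,dy)$ on $\mathbb R^2\times\mathbb R^2$ with finite second moments, with $y$-marginal $\nu$ and with $\gamma(y\,|\,x)=x$ (the conditional expectation of $y$ given $x$ is $x$). An optimal plan is a minimizer of $\int c\,d\gamma$ over $\gamma\in\Gamma(\nu)$. An optimal map is a minimizer of $\mathbb E[c(X,Y)]$ over all square-integrable, $Y$-measurable random variables $X$ with values in $\mathbb R^2$ such that $\mathbb E[Y\,|\,X]=X$; random variables that are almost surely equal are identified. A set $G\subset\mathbb R^2$ is monotone if $c(r,s)\ge 0$ for all $r,s\in G$, and maximal monotone if, in addition, it is not a proper subset of a monotone set. For a maximal monotone set $G$ put $\phi_G(y)=\inf_{x\in G}c(x,y)\in[-\infty,0]$ and $\operatorname{dom}\phi_G=\{\phi_G>-\infty\}$. At interior points of $\operatorname{dom}\phi_G$ the gradient $\nabla\phi_G$ is the classical one; at boundary points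 belonging to $\operatorname{dom}\phi_G$ it is the limit, if it exists, of the classical gradients at interior points of differentiability. Call a Borel probability measure $\mu$ on $\mathbb R^2$ $\mathcal D$-regular if $\mu(D)=0$ for every graph $D$ of a function $f$ on a closed interval of $\mathbb R$ (possibly reduced to a point) such that, for some constant $K>0$, $\frac1K(t-s)\le f(s)-f(t)\le K(t-s)$ for all $s<t$ in the interval. Theorem. Suppose that $\nu$ is $\mathcal D$-regular and that the laws of $Y_1$ and $Y_2$ are atomless. Let $G$ be a maximizer of $\int\phi_G\,d\nu$ over all maximal monotone sets $G$, and write $\phi=\phi_G$. Then $\nabla\phi(Y)$ exists almost surely, the random variable $X=(X_1,X_2)$ given almost surely by $$X_1=Y_1-\frac{\partial\phi}{\partial y_2}(Y),\qquad X_2=Y_2-\frac{\partial\phi}{\partial y_1}(Y)$$ is the unique optimal map, and the law of $(X,Y)$ is the unique optimal plan. Moreover, the law of $X$ is $\mathcal D$-regular and the laws of $X_1$ and $X_2$ are atomless. -/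

import Mathlib

open MeasureTheory Set Filter Topology
open scoped ENNReal

namespace BackwardMOT

noncomputable section

/-- The covariance-type cost `c(x, y) = (x₁ - y₁)(x₂ - y₂)` on the plane. -/
def cost (x y : ℝ × ℝ) : ℝ := (x.1 - y.1) * (x.2 - y.2)

/-! ### Optimal plans -/

/-- `Γ(ν)`: the probability measures `γ(dx, dy)` on `ℝ² × ℝ²` with finite second moments, with
`y`-marginal `ν`, and with the martingale property `γ(y | x) = x`. -/
def martingalePlans (ν : Measure (ℝ × ℝ)) : Set (Measure ((ℝ × ℝ) × (ℝ × ℝ))) :=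
  {γ | IsProbabilityMeasure γ ∧ MemLp id 2 γ ∧ γ.map Prod.snd = ν ∧
    γ[Prod.snd | MeasurableSpace.comap Prod.fst inferInstance] =ᵐ[γ] Prod.fst}

/-- `γ` minimizes `∫ c(x, y) dγ` over `Γ(ν)`. -/
def IsOptimalPlan (ν : Measure (ℝ × ℝ)) (γ : Measure ((ℝ × ℝ) × (ℝ × ℝ))) : Prop :=
  γ ∈ martingalePlans ν ∧
    ∀ γ' ∈ martingalePlans ν, ∫ z, cost z.1 z.2 ∂γ ≤ ∫ z, cost z.1 z.2 ∂γ'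

/-! ### Optimal maps -/

/-- `𝒳(Y)`: the square integrable, `Y`-measurable random variables `X` such that
`𝔼[Y | X] = X`. -/
def martingaleMaps {Ω : Type*} [MeasurableSpace Ω] (P : Measure Ω) (Y : Ω → ℝ × ℝ) :
    Set (Ω → ℝ × ℝ) :=
  {X | Measurable[MeasurableSpace.comap Y inferInstance] X ∧ MemLp X 2 P ∧
    P[Y | MeasurableSpace.comap X inferInstance] =ᵐ[P] X}

/-- `X` minimizes `𝔼[c(X, Y)]` over `𝒳(Y)`. -/
def IsOptimalMap {Ω : Type*} [MeasurableSpace Ω] (P : Measure Ω) (Y X : Ω → ℝ × ℝ) : Prop :=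
  X ∈ martingaleMaps P Y ∧
    ∀ X' ∈ martingaleMaps P Y, ∫ ω, cost (X ω) (Y ω) ∂P ≤ ∫ ω, cost (X' ω) (Y ω) ∂P

/-! ### Maximal monotone sets and the dual problem -/

/-- `G ⊆ ℝ²` is monotone if `(r₁ - s₁)(r₂ - s₂) ≥ 0` for all `r, s ∈ G`. -/
def IsMonotoneSet (G : Set (ℝ × ℝ)) : Prop := ∀ r ∈ G, ∀ s ∈ G, 0 ≤ cost r s

/-- A monotone set that is not a proper subset of a monotone set. -/
def IsMaximalMonotone (G : Set (ℝ × ℝ)) : Prop := Maximal IsMonotoneSet G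

/-- `φ_G(y) = inf_{x ∈ G} c(x, y)`, an extended real number. -/
def phi (G : Set (ℝ × ℝ)) (y : ℝ × ℝ) : EReal := ⨅ x ∈ G, (cost x y : EReal)

/-- The integral `∫ φ_G dν ∈ [-∞, 0]`. For maximal monotone `G` one has `φ_G ≤ 0`, so that
the integral is minus the Lebesgue integral of the nonnegative function `-φ_G`. -/
def dualValue (ν : Measure (ℝ × ℝ)) (G : Set (ℝ × ℝ)) : EReal :=
  -((∫⁻ y, (-phi G y).toENNReal ∂ν : ℝ≥0∞) : EReal)

/-- `G` maximizes `∫ φ_G dν` over all maximal monotone sets. -/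
def IsDualMaximizer (ν : Measure (ℝ × ℝ)) (G : Set (ℝ × ℝ)) : Prop :=
  IsMaximalMonotone G ∧ ∀ G', IsMaximalMonotone G' → dualValue ν G' ≤ dualValue ν G

/-! ### The gradient of `φ_G` and the operator `Dᶜ` -/

/-- `dom φ_G`: the points where `φ_G > -∞`. -/
def phiDom (G : Set (ℝ × ℝ)) : Set (ℝ × ℝ) := {y | phi G y ≠ ⊥}

/-- The points in the interior of `dom φ_G` where `φ_G` is differentiable in the classical
sense. -/
def interiorGradDom (G : Set (ℝ × ℝ)) : Set (ℝ × ℝ) :=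
  {y | y ∈ interior (phiDom G) ∧ DifferentiableAt ℝ (fun z => (phi G z).toReal) y}

/-- The vector of classical partial derivatives `(∂φ_G/∂y₁, ∂φ_G/∂y₂)`. -/
def interiorGrad (G : Set (ℝ × ℝ)) (y : ℝ × ℝ) : ℝ × ℝ :=
  (fderiv ℝ (fun z => (phi G z).toReal) y (1, 0), fderiv ℝ (fun z => (phi G z).toReal) y (0, 1))

/-- `dom ∇φ_G`: the points of `dom φ_G` where the gradient exists, classically in the interior of
`dom φ_G`, and on its boundary as the limit of the classical gradients. -/
def gradDom (G : Set (ℝ × ℝ)) : Set (ℝ × ℝ) :=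
  {y | y ∈ interiorGradDom G ∨
    (y ∈ phiDom G ∧ y ∉ interior (phiDom G) ∧ y ∈ closure (interiorGradDom G) ∧
      ∃ p, Tendsto (interiorGrad G) (𝓝[interiorGradDom G] y) (𝓝 p))}

open Classical in
/-- The gradient `∇φ_G`, meaningful on `dom ∇φ_G`. -/
def gradPhi (G : Set (ℝ × ℝ)) (y : ℝ × ℝ) : ℝ × ℝ :=
  if y ∈ interior (phiDom G) then interiorGrad G y
  else limUnder (𝓝[interiorGradDom G] y) (interiorGrad G)

/-- `Dᶜφ_G(y) = (y₁ - ∂φ_G/∂y₂(y), y₂ - ∂φ_G/∂y₁(y))`, meaningful on `dom ∇φ_G`. -/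
def Dc (G : Set (ℝ × ℝ)) (y : ℝ × ℝ) : ℝ × ℝ :=
  (y.1 - (gradPhi G y).2, y.2 - (gradPhi G y).1)

/-! ### Regularity of measures -/

/-- The family `𝒟` of graphs of strictly decreasing functions `f` on closed intervals `I` (a point,
a bounded, or an unbounded interval) such that `f` and its inverse are Lipschitz. -/
def decreasingGraphs : Set (Set (ℝ × ℝ)) :=
  {D | ∃ (I : Set ℝ) (f : ℝ → ℝ) (K : ℝ), I.Nonempty ∧ IsClosed I ∧ I.OrdConnected ∧ 0 < K ∧
    (∀ s ∈ I, ∀ t ∈ I, s < t → 1 / K * (t - s) ≤ f s - f t ∧ f s - f t ≤ K * (t - s)) ∧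
    D = (fun t => (t, f t)) '' I}

/-- `μ` is `𝒟`-regular: it gives zero mass to every element of `𝒟`. -/
def IsDRegular (μ : Measure (ℝ × ℝ)) : Prop := ∀ D ∈ decreasingGraphs, μ D = 0

end

end BackwardMOT

/-! ### Maximal monotone sets as curves parametrized by the coordinate sum. -/

namespace BackwardMOT

/-! The candidate map sends `y` to the minimizer `T y` of `c(·, y)` over `G`. The proof shows that
`T` is well defined almost everywhere, that `X = T(Y)` satisfies `E[Y | X] = X`, and that weak
duality then has no gap.

Almost every `y` lies in the open rectangle spanned by `G`, because the remaining points of the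
domain of `φ_G` sit on asymptotes of `G` (`IsParam.ae_mem_rect`). There a minimizer exists. Points
with two minimizers lie on countably many axis-parallel lines or countably many bi-Lipschitz
decreasing graphs, all of them null (`IsParam.ae_exists_isStrictArgmin`). Where the minimizer is
unique, an envelope argument gives `∇φ_G` and identifies `Dc G y` with it.

The martingale property is the Euler-Lagrange equation of the dual problem. Moving `G` horizontally
by `ε f(x₁)` yields `E[f(X₁)(X₂ - Y₂)] = 0` (`first_variation`), hence conditional means given `X₁`
alone; exchanging the coordinates gives the statement given `X₂`. To condition on `X` one needs `X₁`
to determine `X` almost surely. This fails only on the countably many vertical segments of `G`, so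
it suffices that `X₁` has no atoms.

Atoms of `X` are excluded first (`measure_fiber`). At a point of `G` with no segment of one
direction, the fiber of `T` lies strictly on one side of a line, while the first variation
annihilates the corresponding mean. At a corner of `G`, cutting a notch of size `ε` would gain an
amount of order `ε` and lose at most `ε²`, so the corner has no mass. Atoms of `X₁` then reduce to
atoms of `X`, since all `y` on one side of a vertical line that are sent to that line are sent to
the same point.

Finally, replacing `x` by the point of `G` on its antidiagonal writes the duality gap of a plan as a
sum of two nonnegative integrals (`IsParam.integral_cost_eq`). The map `T(Y)` closes the gap, and a
plan with zero gap lives on the graph of `T`, which gives optimality and uniqueness for plans and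
maps alike. -/

/-- A parametrization of a maximal monotone set of the plane by the sum of the coordinates. -/
structure IsParam (G : Set (ℝ × ℝ)) (g : ℝ → ℝ × ℝ) : Prop where
  sum : ∀ s, (g s).1 + (g s).2 = s
  mono_fst : Monotone fun s => (g s).1
  mono_snd : Monotone fun s => (g s).2
  range_eq : range g = G

theorem cost_comm (x y : ℝ × ℝ) : cost x y = cost y x := by
  unfold cost; ring

theorem cost_swap (x y : ℝ × ℝ) : cost x.swap y.swap = cost x y := by
  simp only [cost, Prod.fst_swap, Prod.snd_swap]; ring

theorem continuous_cost : Continuous fun z : (ℝ × ℝ) × (ℝ × ℝ) => cost z.1 z.2 := by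
  unfold cost; fun_prop

theorem measurable_cost : Measurable fun z : (ℝ × ℝ) × (ℝ × ℝ) => cost z.1 z.2 :=
  continuous_cost.measurable

theorem cost_nonneg_iff {x y : ℝ × ℝ} : 0 ≤ cost x y ↔ x ≤ y ∨ y ≤ x := by
  simp only [cost, Prod.le_def, mul_nonneg_iff]
  constructor
  · rintro (h | h)
    · right; constructor <;> linarith [h.1, h.2]
    · left; constructor <;> linarith [h.1, h.2]
  · rintro (h | h)
    · right; constructor <;> linarith [h.1, h.2]
    · left; constructor <;> linarith [h.1, h.2]

theorem IsMonotoneSet.le_or_le {G : Set (ℝ × ℝ)} (hG : IsMonotoneSet G) {x y : ℝ × ℝ}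
    (hx : x ∈ G) (hy : y ∈ G) : x ≤ y ∨ y ≤ x :=
  cost_nonneg_iff.1 (hG x hx y hy)

/-- In the rotated coordinates `s = x₁ + x₂`, `d = x₁ - x₂` one has `4c = (Δs)² - (Δd)²`, so
monotonicity says that `d` is a 1-Lipschitz function of `s`. -/
theorem IsMonotoneSet.abs_sub_le {G : Set (ℝ × ℝ)} (hG : IsMonotoneSet G) {x y : ℝ × ℝ}
    (hx : x ∈ G) (hy : y ∈ G) : |(x.1 - x.2) - (y.1 - y.2)| ≤ |(x.1 + x.2) - (y.1 + y.2)| := by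
  apply sq_le_sq.1
  have := hG x hx y hy
  unfold cost at this
  nlinarith

theorem isMonotoneSet_range_of_lipschitz {d : ℝ → ℝ} (hd : LipschitzWith 1 d) :
    IsMonotoneSet (range fun s => (((s + d s) / 2, (s - d s) / 2) : ℝ × ℝ)) := by
  rintro _ ⟨s, rfl⟩ _ ⟨t, rfl⟩
  have h := hd.dist_le_mul s t
  simp only [Real.dist_eq, NNReal.coe_one, one_mul] at h
  have h2 := sq_le_sq.2 h
  unfold cost
  simp only
  nlinarith

theorem isParam_of_lipschitz {d : ℝ → ℝ} (hd : LipschitzWith 1 d) :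
    IsParam (range fun s => (((s + d s) / 2, (s - d s) / 2) : ℝ × ℝ))
      (fun s => (((s + d s) / 2, (s - d s) / 2) : ℝ × ℝ)) where
  sum s := by simp only; ring
  mono_fst s t h := by
    have h' := hd.dist_le_mul s t
    simp only [Real.dist_eq, NNReal.coe_one, one_mul] at h'
    rw [abs_of_nonpos (sub_nonpos.2 h)] at h'
    have := abs_le.1 h'
    simp only; linarith [this.1, this.2]
  mono_snd s t h := by
    have h' := hd.dist_le_mul s t
    simp only [Real.dist_eq, NNReal.coe_one, one_mul] at h'
    rw [abs_of_nonpos (sub_nonpos.2 h)] at h'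
    have := abs_le.1 h'
    simp only; linarith [this.1, this.2]
  range_eq := rfl

/-- The chord bound makes `S` the graph of a Lipschitz function on its projection, which then
extends to the whole line. It serves both monotone sets (after a rotation) and decreasing graphs
(after a shear). -/
theorem exists_lipschitz_through {S : Set (ℝ × ℝ)} {L : NNReal}
    (hS : ∀ p ∈ S, ∀ q ∈ S, |p.2 - q.2| ≤ L * |p.1 - q.1|) :
    ∃ d : ℝ → ℝ, LipschitzWith L d ∧ ∀ p ∈ S, d p.1 = p.2 := by
  classical
  let d₀ : ℝ → ℝ := fun t => if h : ∃ p ∈ S, p.1 = t then h.choose.2 else 0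
  have hd₀ : ∀ p ∈ S, d₀ p.1 = p.2 := by
    intro p hp
    have h : ∃ q ∈ S, q.1 = p.1 := ⟨p, hp, rfl⟩
    have h1 := hS _ h.choose_spec.1 p hp
    rw [h.choose_spec.2, sub_self, abs_zero, mul_zero] at h1
    have := abs_eq_zero.1 (le_antisymm h1 (abs_nonneg _))
    simp only [d₀, dif_pos h]
    linarith
  have hlip : LipschitzOnWith L d₀ (Prod.fst '' S) := by
    apply LipschitzOnWith.of_dist_le_mul
    rintro _ ⟨p, hp, rfl⟩ _ ⟨q, hq, rfl⟩
    simpa only [hd₀ p hp, hd₀ q hq, Real.dist_eq] using hS p hp q hq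
  obtain ⟨d, hd, hdd⟩ := hlip.extend_real
  exact ⟨d, hd, fun p hp => by rw [← hdd ⟨p, hp, rfl⟩, hd₀ p hp]⟩

theorem IsMaximalMonotone.exists_isParam {G : Set (ℝ × ℝ)} (hG : IsMaximalMonotone G) :
    ∃ g, IsParam G g := by
  obtain ⟨d, hd, hdG⟩ := exists_lipschitz_through (L := 1)
    (S := (fun x : ℝ × ℝ => (x.1 + x.2, x.1 - x.2)) '' G) (by
      rintro _ ⟨x, hx, rfl⟩ _ ⟨y, hy, rfl⟩
      simpa using hG.1.abs_sub_le hx hy)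
  have hsub : G ⊆ range fun s => (((s + d s) / 2, (s - d s) / 2) : ℝ × ℝ) := by
    intro x hx
    refine ⟨x.1 + x.2, ?_⟩
    have : d (x.1 + x.2) = x.1 - x.2 := hdG _ ⟨x, hx, rfl⟩
    simp only [this]
    ext <;> simp only <;> ring
  have := hG.eq_of_subset (isMonotoneSet_range_of_lipschitz hd) hsub
  rw [this]
  exact ⟨_, isParam_of_lipschitz hd⟩

namespace IsParam

variable {G : Set (ℝ × ℝ)} {g : ℝ → ℝ × ℝ}

theorem mono (h : IsParam G g) : Monotone g := fun _ _ hst => ⟨h.mono_fst hst, h.mono_snd hst⟩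

theorem mem (h : IsParam G g) (s : ℝ) : g s ∈ G := h.range_eq ▸ mem_range_self s

theorem apply_sum (h : IsParam G g) {x : ℝ × ℝ} (hx : x ∈ G) : g (x.1 + x.2) = x := by
  rw [← h.range_eq] at hx
  obtain ⟨s, rfl⟩ := hx
  rw [h.sum]

/-- A point comparable with the point of the curve having the same coordinate sum must coincide with
it, so nothing can be added. -/
theorem isMaximalMonotone (h : IsParam G g) : IsMaximalMonotone G := by
  refine ⟨?_, ?_⟩
  · rw [← h.range_eq]
    rintro _ ⟨s, rfl⟩ _ ⟨t, rfl⟩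
    rw [cost_nonneg_iff]
    exact (le_total s t).imp (fun hst => h.mono hst) (fun hst => h.mono hst)
  · intro G' hG' hsub x hx
    have hz := hG'.le_or_le hx (hsub (h.mem (x.1 + x.2)))
    have hs := h.sum (x.1 + x.2)
    have : x = g (x.1 + x.2) := by
      rcases hz with hz | hz
      · ext <;> linarith [hz.1, hz.2]
      · ext <;> linarith [hz.1, hz.2]
    rw [this]; exact h.mem _

theorem lipschitz_fst (h : IsParam G g) : LipschitzWith 1 fun s => (g s).1 := by
  apply LipschitzWith.of_dist_le_mul
  intro s t
  simp only [Real.dist_eq, NNReal.coe_one, one_mul]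
  have e1 := h.sum s
  have e2 := h.sum t
  rcases le_total s t with hst | hst
  · have h1 := h.mono_fst hst
    have h2 := h.mono_snd hst
    simp only at h1 h2
    rw [abs_of_nonpos (by linarith), abs_of_nonpos (by linarith)]; linarith
  · have h1 := h.mono_fst hst
    have h2 := h.mono_snd hst
    simp only at h1 h2
    rw [abs_of_nonneg (by linarith), abs_of_nonneg (by linarith)]; linarith

theorem continuous (h : IsParam G g) : Continuous g := by
  have h1 : Continuous fun s => (g s).1 := h.lipschitz_fst.continuous
  have : g = fun s => ((g s).1, s - (g s).1) := by
    ext s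
    · rfl
    · simp only; linarith [h.sum s]
  rw [this]
  fun_prop

end IsParam

/-! ### Symmetry -/

theorem IsMonotoneSet.swap {G : Set (ℝ × ℝ)} (hG : IsMonotoneSet G) :
    IsMonotoneSet (Prod.swap ⁻¹' G) := by
  intro r hr s hs
  have := hG _ hr _ hs
  rwa [cost_swap] at this

theorem IsMaximalMonotone.swap {G : Set (ℝ × ℝ)} (hG : IsMaximalMonotone G) :
    IsMaximalMonotone (Prod.swap ⁻¹' G) := by
  refine ⟨hG.1.swap, fun G' hG' hsub x hx => ?_⟩
  refine hG.2 hG'.swap (fun y hy => ?_) (show x.swap ∈ Prod.swap ⁻¹' G' by simpa using hx)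
  exact hsub (show y.swap ∈ Prod.swap ⁻¹' G by simpa using hy)

theorem phi_swap (G : Set (ℝ × ℝ)) (y : ℝ × ℝ) : phi (Prod.swap ⁻¹' G) y.swap = phi G y := by
  unfold phi
  refine (Equiv.prodComm ℝ ℝ).iInf_congr fun x => ?_
  simp only [mem_preimage, Equiv.prodComm_apply]
  refine iInf_congr fun hx => ?_
  have := cost_swap x.swap y
  rw [Prod.swap_swap] at this
  rw [this]

theorem exists_isMaximalMonotone_superset {G : Set (ℝ × ℝ)} (hG : IsMonotoneSet G) :
    ∃ G', IsMaximalMonotone G' ∧ G ⊆ G' := by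
  obtain ⟨M, hGM, hM⟩ := zorn_subset_nonempty {G | IsMonotoneSet G} (fun c hc hchain hne => by
    refine ⟨⋃₀ c, ?_, fun s hs => subset_sUnion_of_mem hs⟩
    rintro r ⟨A, hA, hr⟩ s ⟨B, hB, hs⟩
    rcases hchain.total hA hB with h | h
    · exact hc hB r (h hr) s hs
    · exact hc hA r hr s (h hs)) G hG
  exact ⟨M, hM, hGM⟩

/-! ### Minimizers of the cost over `G` and the gradient of `φ_G`. -/

/-- The open rectangle spanned by `G`, a subset of the interior of `dom φ_G`. -/
def rect (G : Set (ℝ × ℝ)) : Set (ℝ × ℝ) :=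
  {y | (∃ r ∈ G, r.1 < y.1 ∧ r.2 < y.2) ∧ ∃ r ∈ G, y.1 < r.1 ∧ y.2 < r.2}

/-- The point `p` is a minimizer of `c(·, y)` over `G`. -/
def IsArgmin (G : Set (ℝ × ℝ)) (y p : ℝ × ℝ) : Prop := p ∈ G ∧ ∀ z ∈ G, cost p y ≤ cost z y

/-- The point `p` is the only minimizer of `c(·, y)` over `G`. -/
def IsStrictArgmin (G : Set (ℝ × ℝ)) (y p : ℝ × ℝ) : Prop :=
  p ∈ G ∧ ∀ z ∈ G, z ≠ p → cost p y < cost z y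

theorem IsStrictArgmin.isArgmin {G : Set (ℝ × ℝ)} {y p : ℝ × ℝ} (h : IsStrictArgmin G y p) :
    IsArgmin G y p := by
  refine ⟨h.1, fun z hz => ?_⟩
  rcases eq_or_ne z p with rfl | hne
  · rfl
  · exact (h.2 z hz hne).le

theorem isOpen_rect (G : Set (ℝ × ℝ)) : IsOpen (rect G) := by
  have : rect G =
      (⋃ r ∈ G, {y | r.1 < y.1 ∧ r.2 < y.2}) ∩ ⋃ r ∈ G, {y | y.1 < r.1 ∧ y.2 < r.2} := by
    ext y
    simp only [rect, mem_inter_iff, mem_iUnion, mem_ofPred_eq, exists_prop]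
  rw [this]
  refine (isOpen_biUnion fun r _ => ?_).inter (isOpen_biUnion fun r _ => ?_)
  · exact (isOpen_lt continuous_const continuous_fst).inter
      (isOpen_lt continuous_const continuous_snd)
  · exact (isOpen_lt continuous_fst continuous_const).inter
      (isOpen_lt continuous_snd continuous_const)

theorem rect_swap (G : Set (ℝ × ℝ)) (y : ℝ × ℝ) :
    y.swap ∈ rect (Prod.swap ⁻¹' G) ↔ y ∈ rect G := by
  simp only [rect, mem_ofPred_eq, mem_preimage, Prod.fst_swap, Prod.snd_swap]
  constructor
  · rintro ⟨⟨r, hr, h1, h2⟩, r', hr', h3, h4⟩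
    exact ⟨⟨r.swap, hr, h2, h1⟩, r'.swap, hr', h4, h3⟩
  · rintro ⟨⟨r, hr, h1, h2⟩, r', hr', h3, h4⟩
    exact ⟨⟨r.swap, by simpa, h2, h1⟩, r'.swap, by simpa, h4, h3⟩

theorem IsStrictArgmin.swap {G : Set (ℝ × ℝ)} {y p : ℝ × ℝ} (h : IsStrictArgmin G y p) :
    IsStrictArgmin (Prod.swap ⁻¹' G) y.swap p.swap := by
  refine ⟨by simpa using h.1, fun z hz hne => ?_⟩
  have := h.2 z.swap hz (fun e => hne (by rw [← e, Prod.swap_swap]))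
  rw [← cost_swap, ← cost_swap z.swap y, Prod.swap_swap] at this
  exact this

theorem phi_le_cost {G : Set (ℝ × ℝ)} {z : ℝ × ℝ} (hz : z ∈ G) (y : ℝ × ℝ) :
    phi G y ≤ (cost z y : EReal) := iInf₂_le z hz

theorem le_phi_iff {G : Set (ℝ × ℝ)} {y : ℝ × ℝ} {a : EReal} :
    a ≤ phi G y ↔ ∀ z ∈ G, a ≤ (cost z y : EReal) := le_iInf₂_iff

theorem IsArgmin.phi_eq {G : Set (ℝ × ℝ)} {y p : ℝ × ℝ} (h : IsArgmin G y p) :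
    phi G y = (cost p y : EReal) :=
  le_antisymm (phi_le_cost h.1 y) (le_phi_iff.2 fun z hz => EReal.coe_le_coe_iff.2 (h.2 z hz))

theorem IsArgmin.toReal_phi {G : Set (ℝ × ℝ)} {y p : ℝ × ℝ} (h : IsArgmin G y p) :
    (phi G y).toReal = cost p y := by rw [h.phi_eq, EReal.toReal_coe]

namespace IsParam

variable {G : Set (ℝ × ℝ)} {g : ℝ → ℝ × ℝ}

theorem isClosed (h : IsParam G g) : IsClosed G := by
  have : G = {x | g (x.1 + x.2) = x} := by
    ext x
    exact ⟨fun hx => h.apply_sum hx, fun hx => by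
      rw [← (show g (x.1 + x.2) = x from hx)]; exact h.mem _⟩
  rw [this]
  have := h.continuous
  exact isClosed_eq (by fun_prop) continuous_id

/-- On the antidiagonal through `y` the cost is minus a square, and `G` meets every antidiagonal. -/
theorem cost_sum_nonpos (h : IsParam G g) (y : ℝ × ℝ) : cost (g (y.1 + y.2)) y ≤ 0 := by
  have hs := h.sum (y.1 + y.2)
  have : cost (g (y.1 + y.2)) y = - ((g (y.1 + y.2)).1 - y.1) ^ 2 := by
    unfold cost
    have : (g (y.1 + y.2)).2 = y.1 + y.2 - (g (y.1 + y.2)).1 := by linarith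
    rw [this]; ring
  rw [this]; nlinarith [sq_nonneg ((g (y.1 + y.2)).1 - y.1)]

theorem exists_cost_nonpos (h : IsParam G g) (y : ℝ × ℝ) : ∃ z ∈ G, cost z y ≤ 0 :=
  ⟨_, h.mem _, h.cost_sum_nonpos y⟩

theorem phi_nonpos (h : IsParam G g) (y : ℝ × ℝ) : phi G y ≤ 0 :=
  (phi_le_cost (h.mem _) y).trans (by exact_mod_cast h.cost_sum_nonpos y)

theorem phi_ne_top (h : IsParam G g) (y : ℝ × ℝ) : phi G y ≠ ⊤ :=
  ((h.phi_nonpos y).trans_lt EReal.zero_lt_top).ne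

theorem le_or_ge (h : IsParam G g) {x y : ℝ × ℝ} (hx : x ∈ G) (hy : y ∈ G) : x ≤ y ∨ y ≤ x :=
  h.isMaximalMonotone.1.le_or_le hx hy

/-- This is the coercivity behind all existence statements: beyond `r` or `r'` the cost only
increases from the positive values `c(r, y)` and `c(r', y)`, whereas the minimum is at most zero.
Only a compact piece of `G` matters. -/
theorem mem_Icc_or_cost (h : IsParam G g) {r r' y z : ℝ × ℝ} (hr : r ∈ G) (hr' : r' ∈ G)
    (hz : z ∈ G) (h1 : r.1 < y.1) (h2 : r.2 < y.2) (h3 : y.1 < r'.1) (h4 : y.2 < r'.2) :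
    z ∈ Icc r r' ∨ min (cost r y) (cost r' y) ≤ cost z y := by
  rcases h.le_or_ge hz hr with h5 | h5
  · right
    refine (min_le_left _ _).trans ?_
    unfold cost
    nlinarith [h5.1, h5.2]
  rcases h.le_or_ge hz hr' with h6 | h6
  · exact Or.inl ⟨h5, h6⟩
  · right
    refine (min_le_right _ _).trans ?_
    unfold cost
    nlinarith [h6.1, h6.2]

theorem _root_.BackwardMOT.IsArgmin.mem_Icc (h : IsParam G g)
    {r r' y p : ℝ × ℝ} (hr : r ∈ G) (hr' : r' ∈ G)
    (hp : IsArgmin G y p) (h1 : r.1 < y.1) (h2 : r.2 < y.2) (h3 : y.1 < r'.1) (h4 : y.2 < r'.2) :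
    p ∈ Icc r r' := by
  refine (h.mem_Icc_or_cost hr hr' hp.1 h1 h2 h3 h4).resolve_right fun h5 => ?_
  obtain ⟨z, hz, hz0⟩ := h.exists_cost_nonpos y
  have := hp.2 z hz
  have h6 : 0 < min (cost r y) (cost r' y) := by
    refine lt_min ?_ ?_
    · exact mul_pos_of_neg_of_neg (by linarith) (by linarith)
    · exact mul_pos (by linarith) (by linarith)
  linarith

theorem exists_isArgmin (h : IsParam G g) {y : ℝ × ℝ} (hy : y ∈ rect G) : ∃ p, IsArgmin G y p := by
  obtain ⟨⟨r, hr, h1, h2⟩, r', hr', h3, h4⟩ := hy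
  have hrr : r ≤ r' := ⟨by linarith, by linarith⟩
  have hcont : Continuous fun z => cost z y := by unfold cost; fun_prop
  obtain ⟨p, hp, hpmin⟩ := (isCompact_Icc (a := r) (b := r')).inter_left h.isClosed |>.exists_isMinOn
    ⟨r, hr, left_mem_Icc.2 hrr⟩ hcont.continuousOn
  refine ⟨p, hp.1, fun z hz => ?_⟩
  rcases h.mem_Icc_or_cost hr hr' hz h1 h2 h3 h4 with h5 | h5
  · exact hpmin ⟨hz, h5⟩
  · refine le_trans (le_min (hpmin ⟨hr, left_mem_Icc.2 hrr⟩) (hpmin ⟨hr', right_mem_Icc.2 hrr⟩)) h5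

theorem rect_subset_interior_phiDom (h : IsParam G g) : rect G ⊆ interior (phiDom G) := by
  refine interior_maximal (fun y hy => ?_) (isOpen_rect G)
  obtain ⟨p, hp⟩ := h.exists_isArgmin hy
  simp only [phiDom, mem_ofPred_eq, hp.phi_eq]
  exact EReal.coe_ne_bot _

/-- Compactness turns strict minimality into a uniform gap away from `p`. This controls
near-minimizers when `y` moves (differentiability) or when `G` moves (first variation). -/
theorem _root_.BackwardMOT.IsStrictArgmin.exists_sep (h : IsParam G g)
    {y p : ℝ × ℝ} (hy : y ∈ rect G)
    (hp : IsStrictArgmin G y p) {δ : ℝ} (hδ : 0 < δ) :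
    ∃ η > 0, ∀ z ∈ G, cost z y < cost p y + η → dist z p < δ := by
  obtain ⟨⟨r, hr, h1, h2⟩, r', hr', h3, h4⟩ := hy
  have h6 : 0 < min (cost r y) (cost r' y) := by
    refine lt_min ?_ ?_
    · exact mul_pos_of_neg_of_neg (by linarith) (by linarith)
    · exact mul_pos (by linarith) (by linarith)
  have hp0 : cost p y ≤ 0 := by
    obtain ⟨z, hz, hz0⟩ := h.exists_cost_nonpos y
    exact (hp.isArgmin.2 z hz).trans hz0
  have hcont : Continuous fun z => cost z y := by unfold cost; fun_prop
  have hcpt : IsCompact (G ∩ Icc r r' ∩ {z | δ ≤ dist z p}) :=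
    (isCompact_Icc.inter_left h.isClosed).inter_right
      (isClosed_le continuous_const (by fun_prop))
  rcases (G ∩ Icc r r' ∩ {z | δ ≤ dist z p}).eq_empty_or_nonempty with he | hne
  · refine ⟨_, h6, fun z hz hlt => ?_⟩
    by_contra! hd
    rcases h.mem_Icc_or_cost hr hr' hz h1 h2 h3 h4 with h5 | h5
    · have : z ∈ G ∩ Icc r r' ∩ {z | δ ≤ dist z p} := ⟨⟨hz, h5⟩, hd⟩
      rw [he] at this; exact this
    · linarith
  · obtain ⟨q, hq, hqmin⟩ := hcpt.exists_isMinOn hne hcont.continuousOn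
    have hqp : q ≠ p := by
      rintro rfl
      have := hq.2
      simp only [mem_ofPred_eq, dist_self] at this
      linarith
    have hlt := hp.2 q hq.1.1 hqp
    refine ⟨min (min (cost r y) (cost r' y)) (cost q y - cost p y), lt_min h6 (by linarith),
      fun z hz hlt' => ?_⟩
    by_contra! hd
    rcases h.mem_Icc_or_cost hr hr' hz h1 h2 h3 h4 with h5 | h5
    · have h7 := hqmin (show z ∈ G ∩ Icc r r' ∩ {z | δ ≤ dist z p} from ⟨⟨hz, h5⟩, hd⟩)
      simp only [mem_ofPred_eq] at h7
      have := min_le_right (min (cost r y) (cost r' y)) (cost q y - cost p y)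
      linarith
    · have := min_le_left (min (cost r y) (cost r' y)) (cost q y - cost p y)
      linarith

theorem abs_cost_sub_cost_le {q y y' : ℝ × ℝ} {K : ℝ} (h1 : |q.1 - y.1| ≤ K) (h2 : |q.2 - y.2| ≤ K)
    (hy : dist y' y ≤ 1) : |cost q y' - cost q y| ≤ (2 * K + 1) * dist y' y := by
  have e1 : |y'.1 - y.1| ≤ dist y' y := by
    rw [← Real.dist_eq]; exact le_max_left _ _
  have e2 : |y'.2 - y.2| ≤ dist y' y := by
    rw [← Real.dist_eq]; exact le_max_right _ _
  have hd : 0 ≤ dist y' y := dist_nonneg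
  have : cost q y' - cost q y = -(q.2 - y.2) * (y'.1 - y.1) - (q.1 - y.1) * (y'.2 - y.2)
      + (y'.1 - y.1) * (y'.2 - y.2) := by unfold cost; ring
  rw [this]
  have a1 : |(q.2 - y.2) * (y'.1 - y.1)| ≤ K * dist y' y := by
    rw [abs_mul]; exact mul_le_mul h2 e1 (abs_nonneg _) ((abs_nonneg _).trans h2)
  have a2 : |(q.1 - y.1) * (y'.2 - y.2)| ≤ K * dist y' y := by
    rw [abs_mul]; exact mul_le_mul h1 e2 (abs_nonneg _) ((abs_nonneg _).trans h2)
  have a3 : |(y'.1 - y.1) * (y'.2 - y.2)| ≤ dist y' y := by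
    rw [abs_mul]
    calc _ ≤ dist y' y * dist y' y := mul_le_mul e1 e2 (abs_nonneg _) hd
      _ ≤ dist y' y := by nlinarith
  rw [abs_le] at *
  constructor <;> linarith [a1.1, a1.2, a2.1, a2.2, a3.1, a3.2]

/-- Envelope argument: `φ_G(y')` is at most `c(p, y')` and equals `c(q, y')` for a minimizer `q`,
which is close to `p` by the separation gap. Both costs are affine in `y' - y` up to the product of
its components. -/
theorem _root_.BackwardMOT.IsStrictArgmin.hasFDerivAt (h : IsParam G g)
    {y p : ℝ × ℝ} (hy : y ∈ rect G)
    (hp : IsStrictArgmin G y p) :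
    HasFDerivAt (fun z => (phi G z).toReal)
      ((y.2 - p.2) • ContinuousLinearMap.fst ℝ ℝ ℝ + (y.1 - p.1) • ContinuousLinearMap.snd ℝ ℝ ℝ)
      y := by
  rw [hasFDerivAt_iff_isLittleO, Asymptotics.isLittleO_iff]
  intro ε hε
  obtain ⟨η, hη, hsep⟩ := hp.exists_sep h hy (δ := ε / 4) (by linarith)
  have hy' := hy
  obtain ⟨⟨r, hr, h1, h2⟩, r', hr', h3, h4⟩ := hy
  set K := max (r'.1 - r.1) (r'.2 - r.2) with hK
  have hK1 : r'.1 - r.1 ≤ K := le_max_left _ _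
  have hK2 : r'.2 - r.2 ≤ K := le_max_right _ _
  have hK0 : 0 < K := by linarith
  have hnear : ∀ᶠ y' in 𝓝 y, (r.1 < y'.1 ∧ r.2 < y'.2) ∧ y'.1 < r'.1 ∧ y'.2 < r'.2 := by
    have : IsOpen {y' : ℝ × ℝ | (r.1 < y'.1 ∧ r.2 < y'.2) ∧ y'.1 < r'.1 ∧ y'.2 < r'.2} := by
      refine IsOpen.inter (IsOpen.inter ?_ ?_) (IsOpen.inter ?_ ?_)
      · exact isOpen_lt continuous_const continuous_fst
      · exact isOpen_lt continuous_const continuous_snd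
      · exact isOpen_lt continuous_fst continuous_const
      · exact isOpen_lt continuous_snd continuous_const
    exact this.mem_nhds ⟨⟨h1, h2⟩, h3, h4⟩
  have hball : ∀ᶠ y' in 𝓝 y, dist y' y < min (min 1 (ε / 4)) (η / (2 * (2 * K + 1))) :=
    Metric.ball_mem_nhds y (by positivity)
  filter_upwards [hnear, hball] with y' hn hb
  have hb1 : dist y' y < 1 := hb.trans_le ((min_le_left _ _).trans (min_le_left _ _))
  have hb2 : dist y' y < ε / 4 := hb.trans_le ((min_le_left _ _).trans (min_le_right _ _))
  have hb3 : dist y' y * (2 * (2 * K + 1)) < η :=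
    (lt_div_iff₀ (by positivity)).1 (hb.trans_le (min_le_right _ _))
  have hrect : y' ∈ rect G := ⟨⟨r, hr, hn.1.1, hn.1.2⟩, r', hr', hn.2.1, hn.2.2⟩
  obtain ⟨q, hq⟩ := h.exists_isArgmin hrect
  have hqI := hq.mem_Icc h hr hr' hn.1.1 hn.1.2 hn.2.1 hn.2.2
  have hpI := hp.isArgmin.mem_Icc h hr hr' h1 h2 h3 h4
  have bd : ∀ x ∈ Icc r r', |x.1 - y.1| ≤ K ∧ |x.2 - y.2| ≤ K := by
    rintro x ⟨⟨a, b⟩, c, d⟩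
    refine ⟨abs_le.2 ⟨?_, ?_⟩, abs_le.2 ⟨?_, ?_⟩⟩ <;> linarith
  have hq1 := abs_le.1 (abs_cost_sub_cost_le (bd q hqI).1 (bd q hqI).2 hb1.le)
  have hp1 := abs_le.1 (abs_cost_sub_cost_le (bd p hpI).1 (bd p hpI).2 hb1.le)
  have hqp := hq.2 p hp.1
  have hqd : dist q p < ε / 4 := hsep q hq.1 (by nlinarith [hq1.1, hp1.2])
  have hpq := hp.isArgmin.2 q hq.1
  rw [hq.toReal_phi, hp.isArgmin.toReal_phi]
  simp only [add_apply, smul_apply,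
    ContinuousLinearMap.coe_fst', ContinuousLinearMap.coe_snd', Prod.fst_sub, Prod.snd_sub,
    smul_eq_mul]
  rw [← dist_eq_norm y' y, Real.norm_eq_abs]
  have e1 : |y'.1 - y.1| ≤ dist y' y := by
    rw [← Real.dist_eq]; exact le_max_left _ _
  have e2 : |y'.2 - y.2| ≤ dist y' y := by
    rw [← Real.dist_eq]; exact le_max_right _ _
  have f1 : |q.1 - p.1| ≤ ε / 4 := by
    rw [← Real.dist_eq]; exact (le_max_left _ _).trans hqd.le
  have f2 : |q.2 - p.2| ≤ ε / 4 := by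
    rw [← Real.dist_eq]; exact (le_max_right _ _).trans hqd.le
  have hd : 0 ≤ dist y' y := dist_nonneg
  have a1 : |(q.2 - p.2) * (y'.1 - y.1)| ≤ ε / 4 * dist y' y := by
    rw [abs_mul]; exact mul_le_mul f2 e1 (abs_nonneg _) (by linarith)
  have a2 : |(q.1 - p.1) * (y'.2 - y.2)| ≤ ε / 4 * dist y' y := by
    rw [abs_mul]; exact mul_le_mul f1 e2 (abs_nonneg _) (by linarith)
  have a3 : |(y'.1 - y.1) * (y'.2 - y.2)| ≤ ε / 4 * dist y' y := by
    rw [abs_mul]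
    calc _ ≤ dist y' y * dist y' y := mul_le_mul e1 e2 (abs_nonneg _) hd
      _ ≤ _ := by nlinarith
  have hεd : 0 ≤ ε * dist y' y := by positivity
  have up : cost q y' - cost p y ≤ cost p y' - cost p y := by linarith
  have lo : cost q y' - cost q y ≤ cost q y' - cost p y := by linarith
  have eu : cost p y' - cost p y = (y.2 - p.2) * (y'.1 - y.1) + (y.1 - p.1) * (y'.2 - y.2)
      + (y'.1 - y.1) * (y'.2 - y.2) := by unfold cost; ring
  have el : cost q y' - cost q y = (y.2 - p.2) * (y'.1 - y.1) + (y.1 - p.1) * (y'.2 - y.2)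
      + (y'.1 - y.1) * (y'.2 - y.2) - (q.2 - p.2) * (y'.1 - y.1)
      - (q.1 - p.1) * (y'.2 - y.2) := by unfold cost; ring
  rw [abs_le] at *
  constructor <;> linarith [a1.1, a1.2, a2.1, a2.2, a3.1, a3.2]

theorem _root_.BackwardMOT.IsStrictArgmin.mem_interiorGradDom (h : IsParam G g)
    {y p : ℝ × ℝ} (hy : y ∈ rect G)
    (hp : IsStrictArgmin G y p) : y ∈ interiorGradDom G :=
  ⟨h.rect_subset_interior_phiDom hy, (hp.hasFDerivAt h hy).differentiableAt⟩

theorem _root_.BackwardMOT.IsStrictArgmin.Dc_eq (h : IsParam G g)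
    {y p : ℝ × ℝ} (hy : y ∈ rect G)
    (hp : IsStrictArgmin G y p) : Dc G y = p := by
  simp only [Dc, gradPhi, if_pos (h.rect_subset_interior_phiDom hy), interiorGrad,
    (hp.hasFDerivAt h hy).fderiv]
  ext <;> simp

end IsParam

/-! ### The domain of `φ_G` outside the rectangle. -/

/-- As `u ≤ a` and `v = s - u`, the factor `v - b` grows at least like `s`; a lower bound on the
product forces `a - u` to be `O(1/s)`. -/
theorem tendsto_of_mul_bounded {u v : ℝ → ℝ} {a b M : ℝ} (hsum : ∀ s, u s + v s = s)
    (hu : ∀ s, u s ≤ a) (hM : ∀ s, -M ≤ (u s - a) * (v s - b)) : Tendsto u atTop (𝓝 a) := by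
  have h0 : Tendsto (fun s : ℝ => a - M / (s - a - b)) atTop (𝓝 (a - 0)) := by
    refine tendsto_const_nhds.sub (Tendsto.const_div_atTop ?_ _)
    have : (fun s : ℝ => s - a - b) = fun s => s + (-a - b) := by ext s; ring
    rw [this]
    exact tendsto_atTop_add_const_right _ _ tendsto_id
  rw [sub_zero] at h0
  refine tendsto_of_tendsto_of_tendsto_of_le_of_le' h0 tendsto_const_nhds ?_
    (Eventually.of_forall hu)
  filter_upwards [eventually_gt_atTop (a + b)] with s hs
  have h1 : 0 < s - a - b := by linarith
  have h2 := hsum s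
  have h3 := hu s
  have h4 := hM s
  have : a - u s ≤ M / (s - a - b) := by
    rw [le_div_iff₀ h1]
    nlinarith
  linarith

theorem tendsto_atBot_of_mul_bounded {u v : ℝ → ℝ} {a b M : ℝ} (hsum : ∀ s, u s + v s = s)
    (hu : ∀ s, a ≤ u s) (hM : ∀ s, -M ≤ (u s - a) * (v s - b)) : Tendsto u atBot (𝓝 a) := by
  have h := tendsto_of_mul_bounded (u := fun s => -u (-s)) (v := fun s => -v (-s)) (a := -a)
    (b := -b) (M := M) (fun s => by linarith [hsum (-s)]) (fun s => by linarith [hu (-s)])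
    (fun s => by have := hM (-s); nlinarith)
  have h2 := (h.comp tendsto_neg_atBot_atTop).neg
  simpa [Function.comp_def] using h2

namespace IsParam

variable {G : Set (ℝ × ℝ)} {g : ℝ → ℝ × ℝ}

theorem exists_le_cost (h : IsParam G g) {y : ℝ × ℝ} (hy : y ∈ phiDom G) :
    ∃ M : ℝ, ∀ s, -M ≤ cost (g s) y := by
  refine ⟨-(phi G y).toReal, fun s => ?_⟩
  have := phi_le_cost (h.mem s) y
  rw [← EReal.coe_toReal (h.phi_ne_top y) hy] at this
  rw [neg_neg]
  exact_mod_cast this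

/-- A point of the domain of `φ_G` outside of the open rectangle has a coordinate that is an
asymptote of `G`. -/
theorem tendsto_of_notMem_rect (h : IsParam G g) {y : ℝ × ℝ} (hy : y ∈ phiDom G)
    (hn : y ∉ rect G) :
    (Tendsto (fun s => (g s).1) atTop (𝓝 y.1) ∨ Tendsto (fun s => (g s).1) atBot (𝓝 y.1)) ∨
      Tendsto (fun s => (g s).2) atTop (𝓝 y.2) ∨ Tendsto (fun s => (g s).2) atBot (𝓝 y.2) := by
  obtain ⟨M, hM⟩ := h.exists_le_cost hy
  have hM1 : ∀ s, -M ≤ ((g s).1 - y.1) * ((g s).2 - y.2) := hM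
  have hM2 : ∀ s, -M ≤ ((g s).2 - y.2) * ((g s).1 - y.1) := fun s => by
    rw [mul_comm]; exact hM s
  have hs1 := h.sum
  have hs2 : ∀ s, (g s).2 + (g s).1 = s := fun s => by rw [add_comm]; exact h.sum s
  by_cases hlow : ∃ r ∈ G, r.1 < y.1 ∧ r.2 < y.2
  · have hup : ¬ ∃ r ∈ G, y.1 < r.1 ∧ y.2 < r.2 := fun hup => hn ⟨hlow, hup⟩
    have : (∀ s, (g s).1 ≤ y.1) ∨ ∀ s, (g s).2 ≤ y.2 := by
      by_contra! hc
      obtain ⟨⟨s, hs⟩, t, ht⟩ := hc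
      exact hup ⟨g (max s t), h.mem _, hs.trans_le (h.mono_fst (le_max_left _ _)),
        ht.trans_le (h.mono_snd (le_max_right _ _))⟩
    rcases this with h1 | h1
    · exact Or.inl (Or.inl (tendsto_of_mul_bounded hs1 h1 hM1))
    · exact Or.inr (Or.inl (tendsto_of_mul_bounded hs2 h1 hM2))
  · have : (∀ s, y.1 ≤ (g s).1) ∨ ∀ s, y.2 ≤ (g s).2 := by
      by_contra! hc
      obtain ⟨⟨s, hs⟩, t, ht⟩ := hc
      exact hlow ⟨g (min s t), h.mem _, (h.mono_fst (min_le_left _ _)).trans_lt hs,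
        (h.mono_snd (min_le_right _ _)).trans_lt ht⟩
    rcases this with h1 | h1
    · exact Or.inl (Or.inr (tendsto_atBot_of_mul_bounded hs1 h1 hM1))
    · exact Or.inr (Or.inr (tendsto_atBot_of_mul_bounded hs2 h1 hM2))

end IsParam

theorem ae_notMem_of_subsingleton {α β : Type*} [MeasurableSpace α] [MeasurableSpace β]
    [MeasurableSingletonClass β] {ν : Measure α} {f : α → β} (hf : Measurable f)
    [NullSingletonClass (ν.map f)] {S : Set β} (hS : S.Subsingleton) : ∀ᵐ y ∂ν, f y ∉ S := by
  have : ∀ᵐ x ∂(ν.map f), x ∉ S := measure_eq_zero_iff_ae_notMem.1 (hS.measure_zero _)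
  exact ae_of_ae_map hf.aemeasurable this

/-- There are at most four asymptote values, one per coordinate and end of the curve, and each is a
null event for an atomless coordinate. -/
theorem IsParam.ae_mem_rect {G : Set (ℝ × ℝ)} {g : ℝ → ℝ × ℝ} (h : IsParam G g)
    {ν : Measure (ℝ × ℝ)} [NullSingletonClass (ν.map Prod.fst)]
    [NullSingletonClass (ν.map Prod.snd)] (hdom : ∀ᵐ y ∂ν, y ∈ phiDom G) :
    ∀ᵐ y ∂ν, y ∈ rect G := by
  have hsub : ∀ (f : ℝ → ℝ) (l : Filter ℝ) [l.NeBot], {a | Tendsto f l (𝓝 a)}.Subsingleton :=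
    fun f l _ a ha b hb => tendsto_nhds_unique ha hb
  filter_upwards [hdom,
    ae_notMem_of_subsingleton (ν := ν) measurable_fst (hsub (fun s => (g s).1) atTop),
    ae_notMem_of_subsingleton (ν := ν) measurable_fst (hsub (fun s => (g s).1) atBot),
    ae_notMem_of_subsingleton (ν := ν) measurable_snd (hsub (fun s => (g s).2) atTop),
    ae_notMem_of_subsingleton (ν := ν) measurable_snd (hsub (fun s => (g s).2) atBot)]
    with y hy h1 h2 h3 h4
  by_contra hn
  rcases h.tendsto_of_notMem_rect hy hn with (h5 | h5) | h5 | h5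
  · exact h1 h5
  · exact h2 h5
  · exact h3 h5
  · exact h4 h5

/-! ### Almost sure uniqueness of the minimizer. -/

/-- A planar set all of whose chords have slopes in `[-K, -1/K]` is contained in an element
of `𝒟`. -/
theorem exists_decreasingGraph_superset {S : Set (ℝ × ℝ)} {K : ℝ} (hK : 1 ≤ K)
    (hS : ∀ p ∈ S, ∀ q ∈ S, p.1 ≤ q.1 →
      1 / K * (q.1 - p.1) ≤ p.2 - q.2 ∧ p.2 - q.2 ≤ K * (q.1 - p.1)) :
    ∃ D ∈ decreasingGraphs, S ⊆ D := by
  have hK0 : 0 < K := by linarith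
  have hinv : 1 / K ≤ 1 := by rw [div_le_one hK0]; exact hK
  -- Adding `m t`, with `-m` the midpoint of the admissible slopes, makes the slope interval
  -- symmetric with radius `(K - 1/K)/2`, so the Lipschitz extension applies.
  set m := (K + 1 / K) / 2 with hm
  have hL0 : 0 ≤ (K - 1 / K) / 2 := by linarith
  obtain ⟨d, hd, hdS⟩ := exists_lipschitz_through (L := ⟨(K - 1 / K) / 2, hL0⟩)
    (S := (fun p : ℝ × ℝ => (p.1, p.2 + m * p.1)) '' S) (by
      have key : ∀ p ∈ S, ∀ q ∈ S, p.1 ≤ q.1 →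
          |(p.2 + m * p.1) - (q.2 + m * q.1)| ≤ (K - 1 / K) / 2 * |p.1 - q.1| := by
        intro p hp q hq hpq
        obtain ⟨h1, h2⟩ := hS p hp q hq hpq
        rw [abs_of_nonpos (a := p.1 - q.1) (by linarith), abs_le]
        constructor <;> (rw [hm]; linarith)
      rintro _ ⟨p, hp, rfl⟩ _ ⟨q, hq, rfl⟩
      rcases le_total p.1 q.1 with h | h
      · exact key p hp q hq h
      · simp only
        rw [abs_sub_comm, abs_sub_comm p.1 q.1]; exact key q hq p hp h)
  refine ⟨_, ⟨univ, fun t => d t - m * t, K, univ_nonempty, isClosed_univ, ordConnected_univ, hK0,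
    ?_, rfl⟩, ?_⟩
  · intro s _ t _ hst
    have h := hd.dist_le_mul s t
    simp only [Real.dist_eq] at h
    change |d s - d t| ≤ (K - 1 / K) / 2 * |s - t| at h
    rw [abs_of_nonpos (a := s - t) (by linarith), abs_le] at h
    constructor <;> (rw [hm]; linarith [h.1, h.2])
  · intro p hp
    have := hdS _ ⟨p, hp, rfl⟩
    simp only at this
    refine ⟨p.1, mem_univ _, ?_⟩
    ext
    · rfl
    · simp only [this]; ring

theorem IsDRegular.measure_eq_zero {ν : Measure (ℝ × ℝ)} (hν : IsDRegular ν) {S : Set (ℝ × ℝ)}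
    {K : ℝ} (hK : 1 ≤ K)
    (hS : ∀ p ∈ S, ∀ q ∈ S, p.1 ≤ q.1 →
      1 / K * (q.1 - p.1) ≤ p.2 - q.2 ∧ p.2 - q.2 ≤ K * (q.1 - p.1)) : ν S = 0 := by
  obtain ⟨D, hD, hSD⟩ := exists_decreasingGraph_superset hK hS
  exact measure_mono_null hSD (hν D hD)

/-- The points with two minimizers that are strictly separated by the given numbers. -/
def splitSet (G : Set (ℝ × ℝ)) (a b c d N : ℝ) : Set (ℝ × ℝ) :=
  {y | ∃ p q, IsArgmin G y p ∧ IsArgmin G y q ∧ p.1 < a ∧ b < q.1 ∧ p.2 < c ∧ d < q.2 ∧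
    -N < p.1 ∧ -N < p.2 ∧ q.1 < N ∧ q.2 < N}

theorem IsArgmin.monotone {G : Set (ℝ × ℝ)} {y y' p p' : ℝ × ℝ} (h : IsArgmin G y p)
    (h' : IsArgmin G y' p') :
    0 ≤ (p.2 - p'.2) * (y.1 - y'.1) + (p.1 - p'.1) * (y.2 - y'.2) := by
  have h1 := h.2 p' h'.1
  have h2 := h'.2 p h.1
  unfold cost at h1 h2
  nlinarith

/-- Two-point monotonicity is applied crosswise: the upper minimizer of one point against the lower
minimizer of the other. The gaps `b - a`, `d - c` and the size bound `N` then pin the chord slopes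
between `-K` and `-1/K`. -/
theorem IsDRegular.measure_splitSet {ν : Measure (ℝ × ℝ)} (hν : IsDRegular ν) (G : Set (ℝ × ℝ))
    {a b c d N : ℝ} (hab : a < b) (hcd : c < d) : ν (splitSet G a b c d N) = 0 := by
  set K := max 1 (max (2 * N / (b - a)) (2 * N / (d - c))) with hKdef
  have hK1 : 1 ≤ K := le_max_left _ _
  have hK2 : 2 * N / (b - a) ≤ K := (le_max_left _ _).trans (le_max_right _ _)
  have hK3 : 2 * N / (d - c) ≤ K := (le_max_right _ _).trans (le_max_right _ _)
  rw [div_le_iff₀ (by linarith)] at hK2 hK3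
  have hK0 : 0 < K := by linarith
  refine hν.measure_eq_zero hK1 ?_
  rintro y ⟨p, q, hp, hq, p1, q1, p2, q2, p3, p4, q3, q4⟩ y' ⟨p', q', hp', hq', p1', q1', p2', q2',
    p3', p4', q3', q4'⟩ hyy
  have e1 := hq.monotone hp'
  have e2 := hq'.monotone hp
  have hΔ : 0 ≤ y'.1 - y.1 := by linarith
  have pos : 0 ≤ y.2 - y'.2 := by
    by_contra! hneg
    nlinarith [mul_nonneg (show 0 ≤ q.2 - p'.2 by linarith) hΔ,
      mul_pos (show 0 < q.1 - p'.1 by linarith) (show 0 < y'.2 - y.2 by linarith)]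
  constructor
  · rw [div_mul_eq_mul_div, one_mul, div_le_iff₀ hK0]
    have f1 : (d - c) * (y'.1 - y.1) ≤ (q.2 - p'.2) * (y'.1 - y.1) :=
      mul_le_mul_of_nonneg_right (by linarith) hΔ
    have f2 : (q.1 - p'.1) * (y.2 - y'.2) ≤ K * (d - c) * (y.2 - y'.2) :=
      mul_le_mul_of_nonneg_right (by linarith) pos
    have : (d - c) * (y'.1 - y.1) ≤ (d - c) * ((y.2 - y'.2) * K) := by nlinarith
    exact le_of_mul_le_mul_left this (by linarith)
  · have f1 : (b - a) * (y.2 - y'.2) ≤ (q'.1 - p.1) * (y.2 - y'.2) :=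
      mul_le_mul_of_nonneg_right (by linarith) pos
    have f2 : (q'.2 - p.2) * (y'.1 - y.1) ≤ K * (b - a) * (y'.1 - y.1) :=
      mul_le_mul_of_nonneg_right (by linarith) hΔ
    have : (b - a) * (y.2 - y'.2) ≤ (b - a) * (K * (y'.1 - y.1)) := by nlinarith
    exact le_of_mul_le_mul_left this (by linarith)

/-- The first coordinates of the vertical segments of `G` that cross the level `c`. -/
def verticalCrossings (G : Set (ℝ × ℝ)) (c : ℝ) : Set ℝ :=
  {a | ∃ b d, (a, b) ∈ G ∧ (a, d) ∈ G ∧ b < c ∧ c < d}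

/-- The bottom of one segment lies below level `c` and the top of the other above it, so
comparability orders their abscissas; by symmetry these agree. Hence `G` has only countably many
vertical segments. -/
theorem IsMonotoneSet.subsingleton_verticalCrossings {G : Set (ℝ × ℝ)} (hG : IsMonotoneSet G)
    (c : ℝ) : (verticalCrossings G c).Subsingleton := by
  have key : ∀ a ∈ verticalCrossings G c, ∀ a' ∈ verticalCrossings G c, a ≤ a' := by
    rintro a ⟨b, d, hb, hd, hbc, hcd⟩ a' ⟨b', d', hb', hd', hbc', hcd'⟩
    rcases hG.le_or_le hb hd' with h | h
    · exact h.1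
    · have := h.2
      simp only at this
      linarith
  exact fun a ha a' ha' => le_antisymm (key a ha a' ha') (key a' ha' a ha)

/-- On a vertical line the cost is affine in `x₂` with slope `x₁ - y₁`; equal values at two heights
force the slope to vanish. -/
theorem IsArgmin.exists_crossing {G : Set (ℝ × ℝ)} {y p q : ℝ × ℝ} (hp : IsArgmin G y p)
    (hq : IsArgmin G y q) (h1 : p.1 = q.1) (h2 : p.2 < q.2) :
    ∃ c : ℚ, y.1 ∈ verticalCrossings G c := by
  obtain ⟨c, hc1, hc2⟩ := exists_rat_btwn h2
  refine ⟨c, p.2, q.2, ?_, ?_, hc1, hc2⟩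
  all_goals
    have e1 := hp.2 q hq.1
    have e2 := hq.2 p hp.1
    have : y.1 = p.1 := by
      unfold cost at e1 e2
      rw [h1] at e1 e2 ⊢
      have : (q.1 - y.1) * (q.2 - p.2) = 0 := by linarith
      rcases mul_eq_zero.1 this with h | h <;> linarith
    rw [this]
  · exact hp.1
  · rw [h1]; exact hq.1

theorem IsArgmin.swap {G : Set (ℝ × ℝ)} {y p : ℝ × ℝ} (h : IsArgmin G y p) :
    IsArgmin (Prod.swap ⁻¹' G) y.swap p.swap := by
  refine ⟨by simpa using h.1, fun z hz => ?_⟩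
  have := h.2 z.swap hz
  rwa [← cost_swap, ← cost_swap z.swap y, Prod.swap_swap] at this

theorem IsParam.ae_exists_isStrictArgmin {G : Set (ℝ × ℝ)} {g : ℝ → ℝ × ℝ} (h : IsParam G g)
    {ν : Measure (ℝ × ℝ)} [NullSingletonClass (ν.map Prod.fst)]
    [NullSingletonClass (ν.map Prod.snd)] (hν : IsDRegular ν) (hrect : ∀ᵐ y ∂ν, y ∈ rect G) :
    ∀ᵐ y ∂ν, ∃ p, IsStrictArgmin G y p := by
  have hmono := h.isMaximalMonotone.1
  have hV : ∀ᵐ y ∂ν, ∀ c : ℚ, y.1 ∉ verticalCrossings G c := ae_all_iff.2 fun c =>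
    ae_notMem_of_subsingleton measurable_fst (hmono.subsingleton_verticalCrossings c)
  have hH : ∀ᵐ y ∂ν, ∀ c : ℚ, y.2 ∉ verticalCrossings (Prod.swap ⁻¹' G) c := ae_all_iff.2 fun c =>
    ae_notMem_of_subsingleton measurable_snd (hmono.swap.subsingleton_verticalCrossings c)
  have hS : ∀ᵐ y ∂ν, ∀ (a b c d : ℚ) (N : ℕ), a < b → c < d → y ∉ splitSet G a b c d N := by
    simp only [ae_all_iff]
    intro a b c d N hab hcd
    exact measure_eq_zero_iff_ae_notMem.1
      (hν.measure_splitSet G (by exact_mod_cast hab) (by exact_mod_cast hcd))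
  filter_upwards [hrect, hV, hH, hS] with y hy hyV hyH hyS
  obtain ⟨p, hp⟩ := h.exists_isArgmin hy
  refine ⟨p, hp.1, fun q hq hne => ?_⟩
  by_contra! hle
  have hq' : IsArgmin G y q := ⟨hq, fun z hz => hle.trans (hp.2 z hz)⟩
  have key : ∀ p q, IsArgmin G y p → IsArgmin G y q → p ≤ q → p ≠ q → False := by
    intro p q hp hq hpq hne
    rcases hpq.1.eq_or_lt with h1 | h1
    · rcases hpq.2.eq_or_lt with h2 | h2
      · exact hne (Prod.ext h1 h2)
      · obtain ⟨c, hc⟩ := hp.exists_crossing hq h1 h2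
        exact hyV c hc
    · rcases hpq.2.eq_or_lt with h2 | h2
      · obtain ⟨c, hc⟩ := hp.swap.exists_crossing hq.swap h2 h1
        exact hyH c hc
      · obtain ⟨a, ha1, ha2⟩ := exists_rat_btwn h1
        obtain ⟨b, hb1, hb2⟩ := exists_rat_btwn ha2
        obtain ⟨c, hc1, hc2⟩ := exists_rat_btwn h2
        obtain ⟨d, hd1, hd2⟩ := exists_rat_btwn hc2
        obtain ⟨N, hN⟩ := exists_nat_gt (max (max (-p.1) (-p.2)) (max q.1 q.2))
        simp only [max_lt_iff] at hN
        exact hyS a b c d N (by exact_mod_cast hb1) (by exact_mod_cast hd1)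
          ⟨p, q, hp, hq, ha1, hb2, hc1, hd2, by linarith [hN.1.1], by linarith [hN.1.2], hN.2.1,
            hN.2.2⟩
  rcases hmono.le_or_le hp.1 hq with h1 | h1
  · exact key p q hp hq' h1 (Ne.symm hne)
  · exact key q p hq' hp h1 hne

/-! ### Finiteness of the dual value and comparison with competitors. -/

theorem measurable_phi (G : Set (ℝ × ℝ)) : Measurable (phi G) := by
  refine UpperSemicontinuous.measurable ?_
  refine upperSemicontinuous_biInf fun z _ => Continuous.upperSemicontinuous ?_
  exact continuous_coe_real_ereal.comp (by unfold cost; fun_prop)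

theorem measurable_neg_phi_toENNReal (G : Set (ℝ × ℝ)) :
    Measurable fun y => (-phi G y).toENNReal :=
  ((continuous_neg (G := EReal)).measurable.comp (measurable_phi G)).ereal_toENNReal

theorem neg_phi_toENNReal_of_mem {G : Set (ℝ × ℝ)} {y : ℝ × ℝ} (hy : y ∈ phiDom G) :
    (-phi G y).toENNReal = ENNReal.ofReal (-(phi G y).toReal) := by
  rw [EReal.toENNReal_of_ne_top, EReal.toReal_neg_eq]
  rwa [Ne, EReal.neg_eq_top_iff]

theorem IsDualMaximizer.lintegral_le {ν : Measure (ℝ × ℝ)} {G G' : Set (ℝ × ℝ)}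
    (hG : IsDualMaximizer ν G) (hG' : IsMaximalMonotone G') :
    ∫⁻ y, (-phi G y).toENNReal ∂ν ≤ ∫⁻ y, (-phi G' y).toENNReal ∂ν := by
  have := hG.2 G' hG'
  simp only [dualValue, EReal.neg_le_neg_iff] at this
  exact EReal.coe_ennreal_le_coe_ennreal_iff.1 this

/-- The diagonal is maximal monotone. -/
theorem isParam_diagonal :
    IsParam (range fun s : ℝ => ((s / 2, s / 2) : ℝ × ℝ)) fun s => (s / 2, s / 2) where
  sum s := by simp
  mono_fst s t h := by simp only; linarith
  mono_snd s t h := by simp only; linarith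
  range_eq := rfl

theorem neg_phi_diagonal_le (y : ℝ × ℝ) :
    (-phi (range fun s : ℝ => ((s / 2, s / 2) : ℝ × ℝ)) y).toENNReal ≤
      ENNReal.ofReal ((y.1 - y.2) ^ 2 / 4) := by
  have h : ((-((y.1 - y.2) ^ 2 / 4) : ℝ) : EReal) ≤
      phi (range fun s : ℝ => ((s / 2, s / 2) : ℝ × ℝ)) y := by
    rw [le_phi_iff]
    rintro _ ⟨s, rfl⟩
    rw [EReal.coe_le_coe_iff]
    simp only [cost]
    -- On the diagonal, `4c = (s - y₁ - y₂)² - (y₁ - y₂)²`.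
    nlinarith [sq_nonneg (s - y.1 - y.2)]
  rw [← EReal.real_coe_toENNReal]
  apply EReal.toENNReal_le_toENNReal
  rw [EReal.neg_le, ← EReal.coe_neg]
  exact h

/-- The diagonal is an admissible competitor whose value is finite by square integrability, and a
maximizer does at least as well. -/
theorem IsDualMaximizer.lintegral_lt_top {ν : Measure (ℝ × ℝ)} {G : Set (ℝ × ℝ)}
    (hG : IsDualMaximizer ν G) (hL2 : MemLp id 2 ν) :
    ∫⁻ y, (-phi G y).toENNReal ∂ν < ⊤ := by
  refine (hG.lintegral_le isParam_diagonal.isMaximalMonotone).trans_lt ?_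
  refine (lintegral_mono neg_phi_diagonal_le).trans_lt ?_
  have h1 : MemLp (fun y : ℝ × ℝ => y.1) 2 ν := hL2.fst
  have h2 : MemLp (fun y : ℝ × ℝ => y.2) 2 ν := hL2.snd
  have : Integrable (fun y : ℝ × ℝ => (y.1 - y.2) ^ 2 / 4) ν := (h1.sub h2).integrable_sq.div_const 4
  exact this.lintegral_lt_top

theorem IsDualMaximizer.ae_mem_phiDom {ν : Measure (ℝ × ℝ)} {G : Set (ℝ × ℝ)}
    (hG : IsDualMaximizer ν G) (hL2 : MemLp id 2 ν) : ∀ᵐ y ∂ν, y ∈ phiDom G := by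
  filter_upwards [ae_lt_top (measurable_neg_phi_toENNReal G) (hG.lintegral_lt_top hL2).ne]
    with y hy hbot
  rw [hbot] at hy
  simp at hy

theorem integrable_toReal_phi {ν : Measure (ℝ × ℝ)} {G : Set (ℝ × ℝ)} (hG : IsMaximalMonotone G)
    (hdom : ∀ᵐ y ∂ν, y ∈ phiDom G) (hfin : ∫⁻ y, (-phi G y).toENNReal ∂ν < ⊤) :
    Integrable (fun y => (phi G y).toReal) ν := by
  obtain ⟨g, hg⟩ := hG.exists_isParam
  refine ⟨(measurable_phi G).ereal_toReal.aestronglyMeasurable, ?_⟩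
  refine lt_of_le_of_lt (lintegral_mono_ae ?_) hfin
  filter_upwards [hdom] with y hy
  rw [neg_phi_toENNReal_of_mem hy, ← ofReal_norm, Real.norm_eq_abs, abs_of_nonpos]
  exact EReal.toReal_nonpos (hg.phi_nonpos y)

theorem integral_toReal_phi {ν : Measure (ℝ × ℝ)} {G : Set (ℝ × ℝ)} (hG : IsMaximalMonotone G)
    (hdom : ∀ᵐ y ∂ν, y ∈ phiDom G) :
    ∫ y, (phi G y).toReal ∂ν = -(∫⁻ y, (-phi G y).toENNReal ∂ν).toReal := by
  obtain ⟨g, hg⟩ := hG.exists_isParam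
  have h1 : ∫ y, -(phi G y).toReal ∂ν = (∫⁻ y, (-phi G y).toENNReal ∂ν).toReal := by
    rw [integral_eq_lintegral_of_nonneg_ae]
    · congr 1
      refine lintegral_congr_ae ?_
      filter_upwards [hdom] with y hy
      rw [neg_phi_toENNReal_of_mem hy]
    · refine Eventually.of_forall fun y => ?_
      have := EReal.toReal_nonpos (hg.phi_nonpos y)
      simp only [Pi.zero_apply]
      linarith
    · exact (measurable_phi G).ereal_toReal.neg.aestronglyMeasurable
  rw [integral_neg] at h1
  linarith

/-- The standing situation: `G` is a dual maximizer, and `T y` is almost surely the only minimizer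
of `c(·, y)` over `G`. -/
structure IsDualPair (ν : Measure (ℝ × ℝ)) (G : Set (ℝ × ℝ)) (T : ℝ × ℝ → ℝ × ℝ) : Prop where
  memLp : MemLp id 2 ν
  isDualMaximizer : IsDualMaximizer ν G
  measurable : Measurable T
  ae_mem_rect : ∀ᵐ y ∂ν, y ∈ rect G
  ae_isStrictArgmin : ∀ᵐ y ∂ν, IsStrictArgmin G y (T y)

namespace IsDualPair

variable {ν : Measure (ℝ × ℝ)} {G : Set (ℝ × ℝ)} {T : ℝ × ℝ → ℝ × ℝ}

theorem integrable_phi (h : IsDualPair ν G T) : Integrable (fun y => (phi G y).toReal) ν :=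
  integrable_toReal_phi h.isDualMaximizer.1 (h.isDualMaximizer.ae_mem_phiDom h.memLp)
    (h.isDualMaximizer.lintegral_lt_top h.memLp)

theorem memLp_fst (h : IsDualPair ν G T) : MemLp (fun y => y.1) 2 ν := h.memLp.fst

theorem memLp_snd (h : IsDualPair ν G T) : MemLp (fun y => y.2) 2 ν := h.memLp.snd

/-- A competitor whose cost function is bounded below by `φ_G + ψ` has `∫ ψ ≤ 0`. -/
theorem integral_nonpos (h : IsDualPair ν G T) {G' : Set (ℝ × ℝ)} (hG' : IsMaximalMonotone G')
    {ψ : ℝ × ℝ → ℝ} (hψ : Integrable ψ ν)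
    (hle : ∀ᵐ y ∂ν, ∀ z ∈ G', (phi G y).toReal + ψ y ≤ cost z y) : ∫ y, ψ y ∂ν ≤ 0 := by
  obtain ⟨g, hg⟩ := hG'.exists_isParam
  have hle' : ∀ᵐ y ∂ν, (((phi G y).toReal + ψ y : ℝ) : EReal) ≤ phi G' y := by
    filter_upwards [hle] with y hy
    exact le_phi_iff.2 fun z hz => EReal.coe_le_coe_iff.2 (hy z hz)
  have hdom' : ∀ᵐ y ∂ν, y ∈ phiDom G' := by
    filter_upwards [hle'] with y hy hbot
    rw [hbot, le_bot_iff] at hy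
    exact EReal.coe_ne_bot _ hy
  have hreal : ∀ᵐ y ∂ν, (phi G y).toReal + ψ y ≤ (phi G' y).toReal := by
    filter_upwards [hle', hdom'] with y hy hd
    rwa [← EReal.coe_toReal (hg.phi_ne_top y) hd, EReal.coe_le_coe_iff] at hy
  have hint' : Integrable (fun y => (phi G' y).toReal) ν := by
    refine (h.integrable_phi.add hψ).mono (measurable_phi G').ereal_toReal.aestronglyMeasurable ?_
    filter_upwards [hreal] with y hy
    have h0 := EReal.toReal_nonpos (hg.phi_nonpos y)
    simp only [Pi.add_apply, Real.norm_eq_abs]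
    rw [abs_of_nonpos h0, abs_of_nonpos (hy.trans h0)]
    linarith
  have hfin' : ∫⁻ y, (-phi G' y).toENNReal ∂ν < ⊤ := by
    refine lt_of_le_of_lt (lintegral_mono_ae ?_) hint'.2
    filter_upwards [hdom'] with y hy
    rw [neg_phi_toENNReal_of_mem hy, ← ofReal_norm, Real.norm_eq_abs]
    exact ENNReal.ofReal_le_ofReal (neg_le_abs _)
  have h1 : ∫ y, ((phi G y).toReal + ψ y) ∂ν ≤ ∫ y, (phi G' y).toReal ∂ν :=
    integral_mono_ae (h.integrable_phi.add hψ) hint' hreal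
  rw [integral_add h.integrable_phi hψ,
    integral_toReal_phi h.isDualMaximizer.1 (h.isDualMaximizer.ae_mem_phiDom h.memLp),
    integral_toReal_phi hG' hdom'] at h1
  have h2 := ENNReal.toReal_mono hfin'.ne (h.isDualMaximizer.lintegral_le hG')
  linarith

theorem dualValue_swap (ν : Measure (ℝ × ℝ)) (G : Set (ℝ × ℝ)) :
    dualValue (ν.map Prod.swap) (Prod.swap ⁻¹' G) = dualValue ν G := by
  simp only [dualValue]
  rw [lintegral_map (measurable_neg_phi_toENNReal _) measurable_swap]
  simp only [phi_swap]

/-- This halves the work: each result on vertical slices or on `X₁` transfers to horizontal slices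
and `X₂`. -/
theorem swap (h : IsDualPair ν G T) :
    IsDualPair (ν.map Prod.swap) (Prod.swap ⁻¹' G) (Prod.swap ∘ T ∘ Prod.swap) where
  memLp := by
    rw [memLp_map_measure_iff aestronglyMeasurable_id measurable_swap.aemeasurable]
    exact MemLp.of_fst_snd ⟨h.memLp_snd, h.memLp_fst⟩
  isDualMaximizer := by
    refine ⟨h.isDualMaximizer.1.swap, fun G' hG' => ?_⟩
    rw [dualValue_swap]
    have := h.isDualMaximizer.2 _ hG'.swap
    rwa [← dualValue_swap, ← preimage_comp, Prod.swap_swap_eq, preimage_id] at this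
  measurable := measurable_swap.comp (h.measurable.comp measurable_swap)
  ae_mem_rect := by
    have e := (MeasurableEquiv.prodComm (α := ℝ) (β := ℝ)).measurableEmbedding
    refine (e.ae_map_iff (μ := ν)).2 ?_
    filter_upwards [h.ae_mem_rect] with y hy
    exact (rect_swap G y).2 hy
  ae_isStrictArgmin := by
    have e := (MeasurableEquiv.prodComm (α := ℝ) (β := ℝ)).measurableEmbedding
    refine (e.ae_map_iff (μ := ν)).2 ?_
    filter_upwards [h.ae_isStrictArgmin] with y hy
    change IsStrictArgmin _ y.swap (T y.swap.swap).swap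
    rw [Prod.swap_swap]
    exact hy.swap

end IsDualPair

/-! ### First variation of the dual problem. -/

/-- The open interval spanned by the first coordinates of `G`. -/
def fstRange (G : Set (ℝ × ℝ)) : Set ℝ := {a | (∃ r ∈ G, r.1 < a) ∧ ∃ r ∈ G, a < r.1}

theorem IsMonotoneSet.le_of_fst_lt {G : Set (ℝ × ℝ)} (hG : IsMonotoneSet G) {x y : ℝ × ℝ}
    (hx : x ∈ G) (hy : y ∈ G) (h : x.1 < y.1) : x ≤ y :=
  (hG.le_or_le hx hy).resolve_right fun h' => not_lt_of_ge h'.1 h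

/-- An order automorphism of the first axis preserves and reflects comparability, hence maximality.
-/
theorem IsMaximalMonotone.image_map_id {G : Set (ℝ × ℝ)} (hG : IsMaximalMonotone G) {e : ℝ → ℝ}
    (he : StrictMono e) (hsurj : Function.Surjective e) :
    IsMaximalMonotone ((fun x : ℝ × ℝ => (e x.1, x.2)) '' G) := by
  have key : ∀ x y : ℝ × ℝ, 0 ≤ cost (e x.1, x.2) (e y.1, y.2) ↔ 0 ≤ cost x y := by
    intro x y
    simp only [cost_nonneg_iff, Prod.le_def, he.le_iff_le]
  refine ⟨?_, ?_⟩
  · rintro _ ⟨x, hx, rfl⟩ _ ⟨y, hy, rfl⟩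
    exact (key x y).2 (hG.1 x hx y hy)
  · intro G' hG' hsub x hx
    obtain ⟨a, ha⟩ := hsurj x.1
    have hxe : x = (e (a, x.2).1, (a, x.2).2) := by rw [ha]
    have hmono : IsMonotoneSet ((fun x : ℝ × ℝ => (e x.1, x.2)) ⁻¹' G') :=
      fun r hr s hs => (key r s).1 (hG' _ hr _ hs)
    refine ⟨(a, x.2), hG.2 hmono (fun r hr => hsub ⟨r, hr, rfl⟩) ?_, hxe.symm⟩
    rw [mem_preimage, ← hxe]
    exact hx

theorem strictMono_id_add_mul {f : ℝ → ℝ} {L : NNReal} (hf : LipschitzWith L f) {ε : ℝ}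
    (hε0 : 0 ≤ ε) (hε : ε * L < 1) : StrictMono fun t => t + ε * f t := by
  intro s t hst
  have h := hf.dist_le_mul s t
  simp only [Real.dist_eq] at h
  rw [abs_of_nonpos (a := s - t) (by linarith), abs_le] at h
  have h1 : ε * (f s - f t) ≤ ε * (L * -(s - t)) := mul_le_mul_of_nonneg_left h.2 hε0
  have h2 : ε * L * (t - s) < 1 * (t - s) := mul_lt_mul_of_pos_right hε (by linarith)
  simp only
  nlinarith

theorem surjective_id_add_mul {f : ℝ → ℝ} (hf : Continuous f) {C : ℝ} (hC : ∀ t, |f t| ≤ C)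
    (ε : ℝ) : Function.Surjective fun t => t + ε * f t := by
  have hb : ∀ t, |ε * f t| ≤ |ε| * C := fun t => by
    rw [abs_mul]; exact mul_le_mul_of_nonneg_left (hC t) (abs_nonneg _)
  refine Continuous.surjective (by fun_prop) ?_ ?_
  · exact tendsto_atTop_add_right_of_le _ (-(|ε| * C)) tendsto_id fun t => (abs_le.1 (hb t)).1
  · exact tendsto_atBot_add_right_of_ge _ (|ε| * C) tendsto_id fun t => (abs_le.1 (hb t)).2

theorem IsMonotoneSet.exists_snd_bound {G : Set (ℝ × ℝ)} (hG : IsMonotoneSet G) {l r : ℝ}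
    (hl : l ∈ fstRange G) (hr : r ∈ fstRange G) :
    ∃ M, 0 ≤ M ∧ ∀ x ∈ G, x.1 ∈ Icc l r → |x.2| ≤ M := by
  obtain ⟨⟨p, hp, hpl⟩, -⟩ := hl
  obtain ⟨-, q, hq, hqr⟩ := hr
  refine ⟨max |p.2| |q.2|, le_max_of_le_left (abs_nonneg _), fun x hx hx1 => ?_⟩
  have h1 := hG.le_of_fst_lt hp hx (hpl.trans_le hx1.1)
  have h2 := hG.le_of_fst_lt hx hq (hx1.2.trans_lt hqr)
  exact abs_le_max_abs_abs h1.2 h2.2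

theorem IsMonotoneSet.exists_snd_bound_of_compact {G : Set (ℝ × ℝ)} (hG : IsMonotoneSet G)
    {K : Set ℝ} (hK : IsCompact K) (hKG : K ⊆ fstRange G) :
    ∃ M, 0 ≤ M ∧ ∀ x ∈ G, x.1 ∈ K → |x.2| ≤ M := by
  rcases K.eq_empty_or_nonempty with rfl | hne
  · exact ⟨0, le_rfl, fun x _ hx => hx.elim⟩
  obtain ⟨M, hM0, hM⟩ := hG.exists_snd_bound (hKG (hK.sInf_mem hne)) (hKG (hK.sSup_mem hne))
  exact ⟨M, hM0, fun x hx hx1 => hM x hx ⟨csInf_le hK.bddBelow hx1, le_csSup hK.bddAbove hx1⟩⟩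

namespace IsDualPair

variable {ν : Measure (ℝ × ℝ)} {G : Set (ℝ × ℝ)} {T : ℝ × ℝ → ℝ × ℝ}

/-- The difference quotients of `φ` along the deformed sets converge to `F (T y) y` because the
minimizer is unique. They are dominated by `B`: where `f(x₁) ≠ 0`, the abscissa lies in a compact
part of `fstRange G`, so `x₂` is bounded on `G`. Optimality makes every quotient have nonpositive
integral. -/
theorem first_variation_nonpos [IsProbabilityMeasure ν] (h : IsDualPair ν G T) {f : ℝ → ℝ}
    (hf : ContDiff ℝ (⊤ : ℕ∞) f) (hfc : HasCompactSupport f) (hfs : tsupport f ⊆ fstRange G) :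
    ∫ y, f (T y).1 * ((T y).2 - y.2) ∂ν ≤ 0 := by
  obtain ⟨g, hg⟩ := h.isDualMaximizer.1.exists_isParam
  obtain ⟨L, hL⟩ := hf.lipschitzWith_of_hasCompactSupport hfc (by simp)
  obtain ⟨C, hC⟩ := hfc.exists_bound_of_continuous hf.continuous
  simp only [Real.norm_eq_abs] at hC
  have hC0 : 0 ≤ C := (abs_nonneg _).trans (hC 0)
  obtain ⟨M, hM0, hM⟩ := h.isDualMaximizer.1.1.exists_snd_bound_of_compact hfc hfs
  set F : ℝ × ℝ → ℝ × ℝ → ℝ := fun x y => f x.1 * (x.2 - y.2) with hF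
  set B : ℝ × ℝ → ℝ := fun y => C * (M + |y.2|) with hB
  have hB0 : ∀ y, 0 ≤ B y := fun y => by positivity
  have hFB : ∀ x ∈ G, ∀ y, |F x y| ≤ B y := by
    intro x hx y
    by_cases hfx : f x.1 = 0
    · simp only [hF, hfx, zero_mul, abs_zero]; exact hB0 y
    · have := hM x hx (subset_tsupport f hfx)
      simp only [hF, hB, abs_mul]
      refine mul_le_mul (hC _) ?_ (abs_nonneg _) hC0
      exact (abs_sub _ _).trans (by linarith)
  -- The factor `1/(L + 1)` keeps `ε L < 1`, so `t ↦ t + ε f(t)` stays strictly increasing.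
  set ε : ℕ → ℝ := fun n => 1 / (L + 1) * (1 / ((n : ℝ) + 1)) with hε
  have hε0 : ∀ n, 0 < ε n := fun n => by positivity
  have hεL : ∀ n, ε n * L < 1 := fun n => by
    have h1 : (1 : ℝ) / ((n : ℝ) + 1) ≤ 1 := by
      rw [div_le_one (by positivity)]; linarith [n.cast_nonneg (α := ℝ)]
    have h2 : ε n ≤ 1 / (L + 1) := by
      simp only [hε]
      exact mul_le_of_le_one_right (by positivity) h1
    calc ε n * L ≤ 1 / (L + 1) * L := mul_le_mul_of_nonneg_right h2 L.2
      _ < 1 := by rw [div_mul_eq_mul_div, div_lt_one (by positivity)]; linarith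
  have hεlim : Tendsto ε atTop (𝓝 0) := by
    have := (tendsto_one_div_add_atTop_nhds_zero_nat (𝕜 := ℝ)).const_mul (1 / ((L : ℝ) + 1))
    rwa [mul_zero] at this
  set Gn : ℕ → Set (ℝ × ℝ) := fun n => (fun x : ℝ × ℝ => (x.1 + ε n * f x.1, x.2)) '' G with hGn
  have hGmax : ∀ n, IsMaximalMonotone (Gn n) := fun n =>
    h.isDualMaximizer.1.image_map_id (strictMono_id_add_mul hL (hε0 n).le (hεL n))
      (surjective_id_add_mul hf.continuous hC (ε n))
  have hcost : ∀ n (x y : ℝ × ℝ), cost (x.1 + ε n * f x.1, x.2) y = cost x y + ε n * F x y := by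
    intro n x y; simp only [cost, hF]; ring
  have hlow : ∀ n, ∀ y p, IsStrictArgmin G y p → ∀ z ∈ Gn n, (phi G y).toReal - ε n * B y ≤ cost z y := by
    rintro n y p hp _ ⟨x, hx, rfl⟩
    rw [hcost, hp.isArgmin.toReal_phi]
    have h1 := hp.isArgmin.2 x hx
    have h2 := mul_le_mul_of_nonneg_left (abs_le.1 (hFB x hx y)).1 (hε0 n).le
    linarith
  have hlow' : ∀ n, ∀ y p a, IsStrictArgmin G y p → (∀ z ∈ Gn n, a ≤ cost z y) →
      a ≤ (phi (Gn n) y).toReal := by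
    intro n y p a hp ha
    obtain ⟨g', hg'⟩ := (hGmax n).exists_isParam
    have h1 : (a : EReal) ≤ phi (Gn n) y := le_phi_iff.2 fun z hz => EReal.coe_le_coe_iff.2 (ha z hz)
    have hbot : phi (Gn n) y ≠ ⊥ := fun hb => by
      rw [hb, le_bot_iff] at h1
      exact EReal.coe_ne_bot _ h1
    rwa [← EReal.coe_toReal (hg'.phi_ne_top y) hbot, EReal.coe_le_coe_iff] at h1
  have hbot : ∀ n, ∀ y p, IsStrictArgmin G y p → phi (Gn n) y ≠ ⊥ := by
    intro n y p hp hb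
    have h1 : (((phi G y).toReal - ε n * B y : ℝ) : EReal) ≤ phi (Gn n) y :=
      le_phi_iff.2 fun z hz => EReal.coe_le_coe_iff.2 (hlow n y p hp z hz)
    rw [hb, le_bot_iff] at h1
    exact EReal.coe_ne_bot _ h1
  have hup : ∀ n, ∀ y p, IsStrictArgmin G y p →
      (phi (Gn n) y).toReal ≤ (phi G y).toReal + ε n * F p y := by
    intro n y p hp
    obtain ⟨g', hg'⟩ := (hGmax n).exists_isParam
    have h1 := phi_le_cost (G := Gn n) (mem_image_of_mem _ hp.1) y
    rw [← EReal.coe_toReal (hg'.phi_ne_top y) (hbot n y p hp), EReal.coe_le_coe_iff, hcost] at h1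
    rwa [hp.isArgmin.toReal_phi]
  set ψ : ℕ → ℝ × ℝ → ℝ := fun n y => ((phi (Gn n) y).toReal - (phi G y).toReal) / ε n with hψ
  have hψmeas : ∀ n, AEStronglyMeasurable (ψ n) ν := fun n =>
    (((measurable_phi (Gn n)).ereal_toReal.sub
      (measurable_phi G).ereal_toReal).div_const _).aestronglyMeasurable
  have hψB : ∀ n, ∀ᵐ y ∂ν, ‖ψ n y‖ ≤ B y := by
    intro n
    filter_upwards [h.ae_isStrictArgmin] with y hy
    have h1 := hup n y _ hy
    have h2 := hlow' n y _ _ hy (hlow n y _ hy)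
    have h3 := mul_le_mul_of_nonneg_left (abs_le.1 (hFB _ hy.1 y)).2 (hε0 n).le
    rw [Real.norm_eq_abs, abs_le]
    simp only [hψ]
    rw [le_div_iff₀ (hε0 n), div_le_iff₀ (hε0 n)]
    constructor <;> linarith
  have hBint : Integrable B ν :=
    ((integrable_const M).add ((h.memLp_snd.integrable (by norm_num)).abs)).const_mul C
  have hlim : ∀ᵐ y ∂ν, Tendsto (fun n => ψ n y) atTop (𝓝 (F (T y) y)) := by
    filter_upwards [h.ae_isStrictArgmin, h.ae_mem_rect] with y hy hyr
    rw [Metric.tendsto_nhds]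
    intro δ hδ
    have hcont : ContinuousAt (fun x => F x y) (T y) := by
      have := hf.continuous
      simp only [hF]
      fun_prop
    obtain ⟨δ', hδ', hball⟩ := Metric.continuousAt_iff.1 hcont (δ / 2) (by linarith)
    obtain ⟨η, hη, hsep⟩ := hy.exists_sep hg hyr hδ'
    have hsmall : ∀ᶠ n in atTop, ε n * (2 * B y) < η := by
      have := hεlim.mul_const (2 * B y)
      rw [zero_mul] at this
      exact this.eventually_lt_const hη
    filter_upwards [hsmall] with n hn
    have h1 := hup n y _ hy
    have h2 : (phi G y).toReal + ε n * (F (T y) y - δ / 2) ≤ (phi (Gn n) y).toReal := by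
      refine hlow' n y _ _ hy ?_
      rintro _ ⟨x, hx, rfl⟩
      rw [hcost, hy.isArgmin.toReal_phi]
      by_cases hd : dist x (T y) < δ'
      · have h3 := hball hd
        rw [Real.dist_eq, abs_lt] at h3
        have h4 := hy.isArgmin.2 x hx
        have h5 := mul_le_mul_of_nonneg_left h3.1.le (hε0 n).le
        linarith
      -- Away from `T y` the gap `η` outweighs the perturbation, which changes the comparison by at
      -- most `2 ε B`.
      · have h3 : cost (T y) y + η ≤ cost x y := by
          by_contra! hc
          exact hd (hsep x hx hc)
        have h4 := mul_le_mul_of_nonneg_left (abs_le.1 (hFB x hx y)).1 (hε0 n).le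
        have h5 := mul_le_mul_of_nonneg_left (abs_le.1 (hFB _ hy.1 y)).2 (hε0 n).le
        have h6 : 0 ≤ ε n * (δ / 2) := by have := hε0 n; positivity
        linarith
    have h3 : ψ n y ≤ F (T y) y := by
      simp only [hψ]; rw [div_le_iff₀ (hε0 n)]; linarith
    have h4 : F (T y) y - δ / 2 ≤ ψ n y := by
      simp only [hψ]; rw [le_div_iff₀ (hε0 n)]; linarith
    rw [Real.dist_eq, abs_lt]
    constructor <;> linarith
  have hconv := tendsto_integral_of_dominated_convergence B hψmeas hBint hψB hlim
  refine le_of_tendsto hconv (Eventually.of_forall fun n => ?_)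
  have hψint : Integrable (ψ n) ν := hBint.mono' (hψmeas n) (hψB n)
  have hopt := h.integral_nonpos (hGmax n) (hψint.const_mul (ε n)) (by
    filter_upwards [h.ae_isStrictArgmin] with y hy z hz
    obtain ⟨g', hg'⟩ := (hGmax n).exists_isParam
    have h1 := phi_le_cost hz y
    rw [← EReal.coe_toReal (hg'.phi_ne_top y) (hbot n y _ hy), EReal.coe_le_coe_iff] at h1
    simp only [hψ]
    rw [mul_div_cancel₀ _ (hε0 n).ne']
    linarith)
  rw [integral_const_mul] at hopt
  exact nonpos_of_mul_nonpos_right hopt (hε0 n)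

/-- Horizontal perturbations of a dual maximizer have zero first variation. -/
theorem first_variation [IsProbabilityMeasure ν] (h : IsDualPair ν G T) {f : ℝ → ℝ}
    (hf : ContDiff ℝ (⊤ : ℕ∞) f) (hfc : HasCompactSupport f) (hfs : tsupport f ⊆ fstRange G) :
    ∫ y, f (T y).1 * ((T y).2 - y.2) ∂ν = 0 := by
  refine le_antisymm (h.first_variation_nonpos hf hfc hfs) ?_
  have := h.first_variation_nonpos (f := fun t => -f t) hf.neg
    (hfc.comp_left (g := fun t => -t) neg_zero) ((tsupport_comp_subset (g := fun t => -t) neg_zero f).trans hfs)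
  simp only [neg_mul, integral_neg] at this
  linarith

end IsDualPair

namespace IsDualPair

variable {ν : Measure (ℝ × ℝ)} {G : Set (ℝ × ℝ)} {T : ℝ × ℝ → ℝ × ℝ}

theorem integrableOn_snd [IsProbabilityMeasure ν] (h : IsDualPair ν G T) {l r : ℝ}
    (hl : l ∈ fstRange G) (hr : r ∈ fstRange G) {S : Set (ℝ × ℝ)} (hS : MeasurableSet S)
    (hSI : ∀ y ∈ S, (T y).1 ∈ Icc l r) : IntegrableOn (fun y => (T y).2) S ν := by
  obtain ⟨M, hM0, hM⟩ := h.isDualMaximizer.1.1.exists_snd_bound hl hr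
  refine Integrable.mono' (integrable_const M) h.measurable.snd.aestronglyMeasurable ?_
  rw [ae_restrict_iff' hS]
  filter_upwards [h.ae_isStrictArgmin] with y hy hyS
  exact hM _ hy.1 (hSI y hyS)

theorem integrable_snd [IsProbabilityMeasure ν] (h : IsDualPair ν G T) :
    Integrable (fun y => y.2) ν := h.memLp_snd.integrable (by norm_num)

/-- The conditional mean of `X₂ - Y₂` given `X₁` has the form `w(X₁)`, and the first variation tests
`w` against all smooth functions supported in `(l, r)`. The localization is needed because `X₂` is
not yet known to be integrable. -/
theorem setIntegral_fst_preimage [IsProbabilityMeasure ν] (h : IsDualPair ν G T) {l r : ℝ}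
    (hl : l ∈ fstRange G) (hr : r ∈ fstRange G) {B : Set ℝ} (hB : MeasurableSet B)
    (hBI : B ⊆ Ioo l r) : ∫ y in {y | (T y).1 ∈ B}, ((T y).2 - y.2) ∂ν = 0 := by
  have hX : Measurable fun y => (T y).1 := h.measurable.fst
  set X : ℝ × ℝ → ℝ := fun y => (T y).1 with hXdef
  have hI : MeasurableSet (X ⁻¹' Ioo l r) := hX measurableSet_Ioo
  set W : ℝ × ℝ → ℝ := (X ⁻¹' Ioo l r).indicator fun y => (T y).2 - y.2 with hW
  have hWint : Integrable W ν := by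
    refine (IntegrableOn.sub ?_ h.integrable_snd.integrableOn).integrable_indicator hI
    exact h.integrableOn_snd hl hr hI fun y hy => Ioo_subset_Icc_self hy
  have hm : MeasurableSpace.comap X inferInstance ≤ (inferInstance : MeasurableSpace (ℝ × ℝ)) :=
    hX.comap_le
  obtain ⟨w, hw, hweq⟩ := (stronglyMeasurable_condExp (f := W) (μ := ν)
    (m := MeasurableSpace.comap X inferInstance)).exists_eq_measurable_comp
  have hwint : Integrable w (ν.map X) := by
    rw [integrable_map_measure hw.aestronglyMeasurable hX.aemeasurable, ← hweq]
    exact integrable_condExp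
  have hprob : IsProbabilityMeasure (ν.map X) := Measure.isProbabilityMeasure_map hX.aemeasurable
  have hzero : ∀ᵐ t ∂(ν.map X), t ∈ Ioo l r → w t = 0 := by
    refine isOpen_Ioo.ae_eq_zero_of_integral_contDiff_smul_eq_zero
      (hwint.locallyIntegrable.locallyIntegrableOn _) fun f hf hfc hfs => ?_
    obtain ⟨C, hC⟩ := hfc.exists_bound_of_continuous hf.continuous
    have hsub : Ioo l r ⊆ fstRange G := by
      rintro t ⟨h1, h2⟩
      obtain ⟨⟨p, hp, hpl⟩, -⟩ := hl
      obtain ⟨-, q, hq, hqr⟩ := hr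
      exact ⟨⟨p, hp, hpl.trans h1⟩, q, hq, h2.trans hqr⟩
    have h1 := h.first_variation hf hfc (hfs.trans hsub)
    have h2 : ∀ y, f (T y).1 * ((T y).2 - y.2) = ((f ∘ X) * W) y := by
      intro y
      by_cases hy : y ∈ X ⁻¹' Ioo l r
      · simp only [hW, Pi.mul_apply, Function.comp_apply]
        rw [indicator_of_mem hy]
      · have : f (X y) = 0 := by
          by_contra hne
          exact hy (hfs (subset_tsupport f hne))
        simp only [hW, Pi.mul_apply, indicator_of_notMem hy, mul_zero, Function.comp_apply]
        rw [show f (T y).1 = 0 from this, zero_mul]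
    simp only [h2] at h1
    have hfX : StronglyMeasurable[MeasurableSpace.comap X inferInstance] (f ∘ X) :=
      hf.continuous.stronglyMeasurable.comp_measurable (comap_measurable X)
    have h3 := integral_map (f := fun t => f t • w t) (μ := ν) hX.aemeasurable
      (hf.continuous.aestronglyMeasurable.smul hw.aestronglyMeasurable)
    rw [h3, ← h1, ← integral_condExp (f := f ∘ X * W) hm]
    refine integral_congr_ae ?_
    filter_upwards [condExp_stronglyMeasurable_mul_of_bound hm hfX hWint C
      (Eventually.of_forall fun y => hC (X y))] with y hy
    rw [hy, hweq]
    rfl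
  have hBpre : MeasurableSet (X ⁻¹' B) := hX hB
  have h3 : ∫ y in X ⁻¹' B, W y ∂ν = 0 := by
    rw [← setIntegral_condExp hm hWint ⟨B, hB, rfl⟩, hweq]
    rw [setIntegral_eq_zero_of_ae_eq_zero]
    filter_upwards [ae_of_ae_map hX.aemeasurable hzero] with y hy hyB
    exact hy (hBI hyB)
  rw [← h3]
  refine setIntegral_congr_fun hBpre fun y hy => ?_
  simp only [hW]
  rw [indicator_of_mem (show y ∈ X ⁻¹' Ioo l r from hBI hy)]

theorem exists_Ioo_of_mem_fstRange {a : ℝ} (ha : a ∈ fstRange G) :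
    ∃ l r : ℚ, (l : ℝ) ∈ fstRange G ∧ (r : ℝ) ∈ fstRange G ∧ a ∈ Ioo (l : ℝ) r := by
  obtain ⟨⟨p, hp, hpa⟩, q, hq, hqa⟩ := ha
  obtain ⟨l, hl1, hl2⟩ := exists_rat_btwn hpa
  obtain ⟨r, hr1, hr2⟩ := exists_rat_btwn hqa
  exact ⟨l, r, ⟨⟨p, hp, hl1⟩, q, hq, hl2.trans hqa⟩, ⟨⟨p, hp, hpa.trans hr1⟩, q, hq, hr2⟩, hl2, hr1⟩

theorem setIntegral_fst_eq [IsProbabilityMeasure ν] (h : IsDualPair ν G T) {a : ℝ}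
    (ha : a ∈ fstRange G) : ∫ y in {y | (T y).1 = a}, ((T y).2 - y.2) ∂ν = 0 := by
  obtain ⟨l, r, hl, hr, hlr⟩ := exists_Ioo_of_mem_fstRange ha
  exact h.setIntegral_fst_preimage hl hr (measurableSet_singleton a) (singleton_subset_iff.2 hlr)

theorem setIntegral_snd_eq [IsProbabilityMeasure ν] (h : IsDualPair ν G T) {b : ℝ}
    (hb : (∃ r ∈ G, r.2 < b) ∧ ∃ r ∈ G, b < r.2) :
    ∫ y in {y | (T y).2 = b}, ((T y).1 - y.1) ∂ν = 0 := by
  have : IsProbabilityMeasure (ν.map Prod.swap) :=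
    Measure.isProbabilityMeasure_map measurable_swap.aemeasurable
  have hb' : b ∈ fstRange (Prod.swap ⁻¹' G) := by
    obtain ⟨⟨p, hp, h1⟩, q, hq, h2⟩ := hb
    exact ⟨⟨p.swap, by simpa, h1⟩, q.swap, by simpa, h2⟩
  have h1 := h.swap.setIntegral_fst_eq hb'
  have e := (MeasurableEquiv.prodComm (α := ℝ) (β := ℝ)).measurableEmbedding
  have h2 := e.setIntegral_map (μ := ν)
    (fun y => (((Prod.swap ∘ T ∘ Prod.swap) y).2 - y.2)) {y | ((Prod.swap ∘ T ∘ Prod.swap) y).1 = b}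
  exact h2.symm.trans h1

end IsDualPair

/-! ### Corners of a dual maximizer carry no mass. -/

theorem IsParam.mem_of_mem_Icc_fst {G : Set (ℝ × ℝ)} {g : ℝ → ℝ × ℝ} (h : IsParam G g)
    {x z w : ℝ × ℝ} (hx : x ∈ G) (hz : z ∈ G) (h1 : x.1 = w.1) (h2 : z.1 = w.1)
    (hw : w.2 ∈ Icc x.2 z.2) : w ∈ G := by
  have e1 := h.mono (show x.1 + x.2 ≤ w.1 + w.2 by linarith [hw.1])
  have e2 := h.mono (show w.1 + w.2 ≤ z.1 + z.2 by linarith [hw.2])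
  rw [h.apply_sum hx] at e1
  rw [h.apply_sum hz] at e2
  have e3 := h.sum (w.1 + w.2)
  have : g (w.1 + w.2) = w := by
    have : (g (w.1 + w.2)).1 = w.1 := le_antisymm (h2 ▸ e2.1) (h1 ▸ e1.1)
    exact Prod.ext this (by linarith)
  rw [← this]; exact h.mem _

theorem IsParam.mem_of_mem_Icc_snd {G : Set (ℝ × ℝ)} {g : ℝ → ℝ × ℝ} (h : IsParam G g)
    {x z w : ℝ × ℝ} (hx : x ∈ G) (hz : z ∈ G) (h1 : x.2 = w.2) (h2 : z.2 = w.2)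
    (hw : w.1 ∈ Icc x.1 z.1) : w ∈ G := by
  have e1 := h.mono (show x.1 + x.2 ≤ w.1 + w.2 by linarith [hw.1])
  have e2 := h.mono (show w.1 + w.2 ≤ z.1 + z.2 by linarith [hw.2])
  rw [h.apply_sum hx] at e1
  rw [h.apply_sum hz] at e2
  have e3 := h.sum (w.1 + w.2)
  have : g (w.1 + w.2) = w := by
    have : (g (w.1 + w.2)).2 = w.2 := le_antisymm (h2 ▸ e2.2) (h1 ▸ e1.2)
    exact Prod.ext (by linarith) this
  rw [← this]; exact h.mem _

/-- If a lower-right notch is cut into a corner of a maximal monotone set, then the new set is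
maximal monotone, and its points are controlled by the tip `(a + ε, b - ε)` of the notch and the
points of the old set away from the corner. -/
theorem IsMaximalMonotone.exists_notch {G : Set (ℝ × ℝ)} (hG : IsMaximalMonotone G) {a b ε : ℝ}
    (hε : 0 ≤ ε) (h1 : (a, b - ε) ∈ G) (h2 : (a + ε, b) ∈ G) :
    ∃ G', IsMaximalMonotone G' ∧ ∀ (y : ℝ × ℝ) (m : ℝ),
      (∀ x ∈ G, x ≤ (a, b - ε) ∨ (a + ε, b) ≤ x → m ≤ cost x y) →
      m ≤ cost (a + ε, b - ε) y → ∀ x ∈ G', m ≤ cost x y := by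
  have hmono : IsMonotoneSet
      (insert (a + ε, b - ε) {x | x ∈ G ∧ (x ≤ (a, b - ε) ∨ (a + ε, b) ≤ x)}) := by
    have hq : ∀ x : ℝ × ℝ, x ≤ (a, b - ε) ∨ (a + ε, b) ≤ x →
        x ≤ (a + ε, b - ε) ∨ (a + ε, b - ε) ≤ x := by
      intro x hx
      simp only [Prod.le_def] at hx ⊢
      rcases hx with hx | hx
      · left; constructor <;> linarith [hx.1, hx.2]
      · right; constructor <;> linarith [hx.1, hx.2]
    rintro r (rfl | ⟨hr, hr'⟩) s (rfl | ⟨hs, hs'⟩)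
    · exact cost_nonneg_iff.2 (Or.inl le_rfl)
    · exact cost_nonneg_iff.2 (hq s hs').symm
    · exact cost_nonneg_iff.2 (hq r hr')
    · exact hG.1 r hr s hs
  obtain ⟨G', hG', hsub⟩ := exists_isMaximalMonotone_superset hmono
  refine ⟨G', hG', fun y m hm hq x hx => ?_⟩
  have q0 : (a + ε, b - ε) ∈ G' := hsub (mem_insert _ _)
  have q1 : (a, b - ε) ∈ G' := hsub (mem_insert_of_mem _ ⟨h1, Or.inl le_rfl⟩)
  have q2 : (a + ε, b) ∈ G' := hsub (mem_insert_of_mem _ ⟨h2, Or.inr le_rfl⟩)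
  -- The points removed from `G` lie between the ends of the notch, so `x` is comparable with them
  -- too, and maximality of `G` applies.
  have mem_G : x ≤ (a, b - ε) ∨ (a + ε, b) ≤ x → x ∈ G := by
    intro hxq
    have hins : IsMonotoneSet (insert x G) := by
      have key : ∀ r ∈ G, 0 ≤ cost x r := by
        intro r hr
        by_cases hr' : r ≤ (a, b - ε) ∨ (a + ε, b) ≤ r
        · exact hG'.1 x hx r (hsub (mem_insert_of_mem _ ⟨hr, hr'⟩))
        · push Not at hr'
          have e1 := (hG.1.le_or_le hr h1).resolve_left hr'.1
          have e2 := (hG.1.le_or_le hr h2).resolve_right hr'.2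
          rw [cost_nonneg_iff]
          rcases hxq with hxq | hxq
          · exact Or.inl (hxq.trans e1)
          · exact Or.inr (e2.trans hxq)
      rintro r (rfl | hr) s (rfl | hs)
      · exact cost_nonneg_iff.2 (Or.inl le_rfl)
      · exact key s hs
      · rw [cost_comm]; exact key r hr
      · exact hG.1 r hr s hs
    exact hG.2 hins (subset_insert _ _) (mem_insert _ _)
  have m1 := hm _ h1 (Or.inl le_rfl)
  have m2 := hm _ h2 (Or.inr le_rfl)
  unfold cost at m1 m2 hq ⊢
  simp only at m1 m2 hq
  rcases hG'.1.le_or_le hx q1 with h3 | h3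
  · exact hm x (mem_G (Or.inl h3)) (Or.inl h3)
  rcases hG'.1.le_or_le hx q2 with h4 | h4
  swap
  · exact hm x (mem_G (Or.inr h4)) (Or.inr h4)
  -- The point is now on one of the two sides of the notch, where the cost is affine and so bounded
  -- below by its values at the ends.
  rcases hG'.1.le_or_le hx q0 with h5 | h5
  · have e : x.2 = b - ε := le_antisymm h5.2 h3.2
    have e1 : a ≤ x.1 := h3.1
    have e2 : x.1 ≤ a + ε := h5.1
    rw [e]
    rcases le_total 0 (b - ε - y.2) with hs | hs
    · nlinarith
    · nlinarith
  · have e : x.1 = a + ε := le_antisymm h4.1 h5.1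
    have e1 : b - ε ≤ x.2 := h5.2
    have e2 : x.2 ≤ b := h4.2
    rw [e]
    rcases le_total 0 (a + ε - y.1) with hs | hs
    · nlinarith
    · nlinarith

namespace IsDualPair

variable {ν : Measure (ℝ × ℝ)} {G : Set (ℝ × ℝ)} {T : ℝ × ℝ → ℝ × ℝ}

/-- The upper-left corners of a dual maximizer have no mass. -/
theorem measure_corner [IsProbabilityMeasure ν] (h : IsDualPair ν G T) {a b d e : ℝ}
    (hp : (a, b) ∈ G) (hd : (a, d) ∈ G) (he : (e, b) ∈ G) (hdb : d < b) (hae : a < e) :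
    ν {y | T y = (a, b)} = 0 := by
  obtain ⟨g, hg⟩ := h.isDualMaximizer.1.exists_isParam
  have hmono := h.isDualMaximizer.1.1
  set δ := min (b - d) (e - a) with hδdef
  have hδ : 0 < δ := lt_min (by linarith) (by linarith)
  have hδ1 : δ ≤ b - d := min_le_left _ _
  have hδ2 : δ ≤ e - a := min_le_right _ _
  have hv : ∀ t, 0 ≤ t → t ≤ δ → (a, b - t) ∈ G := fun t ht0 ht =>
    hg.mem_of_mem_Icc_fst hd hp rfl rfl ⟨by simp only; linarith, by simp only; linarith⟩
  have hh : ∀ t, 0 ≤ t → t ≤ δ → (a + t, b) ∈ G := fun t ht0 ht =>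
    hg.mem_of_mem_Icc_snd hp he rfl rfl ⟨by simp only; linarith, by simp only; linarith⟩
  set far : Set (ℝ × ℝ) := {x | x ∈ G ∧ (x ≤ (a, b - δ) ∨ (a + δ, b) ≤ x)} with hfar
  -- Points of the fiber with quantitative margins: distance `1/(n + 1)` from both corner lines, and
  -- the same cost gap to the part of `G` away from the corner. These sets exhaust the fiber up to a
  -- null set.
  set A : ℕ → Set (ℝ × ℝ) := fun n => {y | T y = (a, b) ∧
    (a + 1 / ((n : ℝ) + 1) ≤ y.1 ∧ y.2 ≤ b - 1 / ((n : ℝ) + 1)) ∧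
    (((phi G y).toReal + 1 / ((n : ℝ) + 1) : ℝ) : EReal) ≤ phi far y} with hA
  have hAmeas : ∀ n, MeasurableSet (A n) := by
    intro n
    refine (h.measurable (measurableSet_singleton _)).inter (MeasurableSet.inter ?_ ?_)
    · exact (measurableSet_le measurable_const measurable_fst).inter
        (measurableSet_le measurable_snd measurable_const)
    · exact measurableSet_le ((measurable_phi G).ereal_toReal.add_const _).coe_real_ereal
        (measurable_phi far)
  have hnull : ∀ n, ν (A n) = 0 := by
    intro n
    set κ : ℝ := 1 / ((n : ℝ) + 1) with hκdef
    have hκ : 0 < κ := by positivity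
    have hmain : ∀ ε, 0 < ε → ε ≤ min (δ / 2) (min κ 1) → κ * ν.real (A n) ≤ ε := by
      intro ε hε hεle
      have hε1 : ε ≤ δ / 2 := hεle.trans (min_le_left _ _)
      have hε2 : ε ≤ κ := hεle.trans ((min_le_right _ _).trans (min_le_left _ _))
      have hε3 : ε ≤ 1 := hεle.trans ((min_le_right _ _).trans (min_le_right _ _))
      obtain ⟨G', hG', hcost⟩ := h.isDualMaximizer.1.exists_notch hε.le
        (hv ε hε.le (by linarith)) (hh ε hε.le (by linarith))
      -- The notch loses at most `ε²` anywhere and gains at least `κ ε - ε²` on `A n`; optimality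
      -- gives `κ ν(A n) ≤ ε`.
      have hint : Integrable (fun y => -ε ^ 2 + (A n).indicator (fun _ => κ * ε) y) ν :=
        (integrable_const _).add ((integrable_const _).indicator (hAmeas n))
      have hopt := h.integral_nonpos hG' hint (by
        filter_upwards [h.ae_isStrictArgmin] with y hy
        rw [hy.isArgmin.toReal_phi]
        have hle := hy.isArgmin.2
        refine hcost y _ ?_ ?_
        · intro x hx hxq
          by_cases hyA : y ∈ A n
          · rw [indicator_of_mem hyA]
            obtain ⟨hTy, ⟨hy1, hy2⟩, hyfar⟩ := hyA
            rw [hTy]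
            have hfarx : x ≤ (a, b - δ) ∨ (a + δ, b) ≤ x → cost (a, b) y + κ ≤ cost x y := by
              intro hx'
              have := hyfar.trans (phi_le_cost (show x ∈ far from ⟨hx, hx'⟩) y)
              rwa [EReal.coe_le_coe_iff, hy.isArgmin.toReal_phi, hTy] at this
            have hκε : κ * ε ≤ κ := by nlinarith
            have hsq := sq_nonneg ε
            rcases hmono.le_or_le hx (hv δ hδ.le le_rfl) with h3 | h3
            · linarith [hfarx (Or.inl h3)]
            rcases hmono.le_or_le hx (hh δ hδ.le le_rfl) with h4 | h4
            swap
            · linarith [hfarx (Or.inr h4)]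
            rcases hxq with hxq | hxq
            · have e1 : x.1 = a := le_antisymm hxq.1 h3.1
              have e2 : x.2 ≤ b - ε := hxq.2
              unfold cost
              simp only
              rw [e1]
              nlinarith
            · have e1 : x.2 = b := le_antisymm h4.2 hxq.2
              have e2 : a + ε ≤ x.1 := hxq.1
              unfold cost
              simp only
              rw [e1]
              nlinarith
          · rw [indicator_of_notMem hyA]
            nlinarith [hle x hx, sq_nonneg ε]
        · by_cases hyA : y ∈ A n
          · rw [indicator_of_mem hyA]
            obtain ⟨hTy, ⟨hy1, hy2⟩, -⟩ := hyA
            rw [hTy]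
            unfold cost
            simp only
            nlinarith
          · rw [indicator_of_notMem hyA]
            have c0 := hle _ hp
            have c1 := hle _ (hv δ hδ.le le_rfl)
            have c2 := hle _ (hh δ hδ.le le_rfl)
            -- Up to `ε²`, the cost at the tip is a convex combination of the costs at three points
            -- of `G`, none of which is below the minimum.
            have key : δ * (cost (a + ε, b - ε) y + ε ^ 2) = (δ - 2 * ε) * cost (a, b) y +
                ε * cost (a, b - δ) y + ε * cost (a + δ, b) y := by
              unfold cost; simp only; ring
            have k0 := mul_le_mul_of_nonneg_left c0 (show 0 ≤ δ - 2 * ε by linarith)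
            have k1 := mul_le_mul_of_nonneg_left c1 hε.le
            have k2 := mul_le_mul_of_nonneg_left c2 hε.le
            have : δ * cost (T y) y ≤ δ * (cost (a + ε, b - ε) y + ε ^ 2) := by linarith
            linarith [le_of_mul_le_mul_left this hδ])
      rw [integral_add (integrable_const _) ((integrable_const _).indicator (hAmeas n)),
        integral_indicator_const _ (hAmeas n)] at hopt
      simp only [integral_const, probReal_univ, smul_eq_mul] at hopt
      have : ε * (κ * ν.real (A n)) ≤ ε * ε := by nlinarith
      exact le_of_mul_le_mul_left this hε
    have h0 : κ * ν.real (A n) ≤ 0 := by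
      by_contra! hc
      set ε := min (κ * ν.real (A n) / 2) (min (δ / 2) (min κ 1)) with hε
      have hεpos : 0 < ε := lt_min (by linarith) (lt_min (by linarith) (lt_min hκ one_pos))
      have := hmain ε hεpos (min_le_right _ _)
      have := min_le_left (κ * ν.real (A n) / 2) (min (δ / 2) (min κ 1))
      linarith
    have h1 : ν.real (A n) ≤ 0 := nonpos_of_mul_nonpos_right h0 hκ
    exact (measureReal_eq_zero_iff).1 (le_antisymm h1 measureReal_nonneg)
  have hcover : ∀ᵐ y ∂ν, T y = (a, b) → y ∈ ⋃ n, A n := by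
    filter_upwards [h.ae_isStrictArgmin, h.ae_mem_rect] with y hy hyr hTy
    obtain ⟨η, hη, hsep⟩ := hy.exists_sep hg hyr hδ
    have hlt := hy.2
    rw [hTy] at hlt hsep
    -- Strict minimality against the vertical arm, and then against the horizontal one, places `y`
    -- to the lower right of the corner.
    have hy1 : a < y.1 := by
      have := hlt _ (hv δ hδ.le le_rfl) (fun e => by
        have := congrArg Prod.snd e; simp only at this; linarith)
      unfold cost at this
      simp only at this
      nlinarith
    have hy2 : y.2 < b := by
      have := hlt _ (hh δ hδ.le le_rfl) (fun e => by
        have := congrArg Prod.fst e; simp only at this; linarith)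
      unfold cost at this
      simp only at this
      nlinarith
    obtain ⟨n, hn⟩ := exists_nat_one_div_lt (show 0 < min η (min (y.1 - a) (b - y.2)) from
      lt_min hη (lt_min (by linarith) (by linarith)))
    rw [lt_min_iff, lt_min_iff] at hn
    refine mem_iUnion.2 ⟨n, hTy, ⟨by linarith, by linarith⟩, ?_⟩
    refine le_phi_iff.2 fun x hx => ?_
    rw [EReal.coe_le_coe_iff, hy.isArgmin.toReal_phi, hTy]
    by_contra! hc
    have hdist := hsep x hx.1 (by linarith)
    rw [Prod.dist_eq, max_lt_iff, Real.dist_eq, Real.dist_eq, abs_lt, abs_lt] at hdist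
    simp only at hdist
    rcases hx.2 with h3 | h3
    · have := h3.2
      simp only at this
      linarith
    · have := h3.1
      simp only at this
      linarith
  have h0 : ν (⋃ n, A n) = 0 := measure_iUnion_null hnull
  refine measure_mono_null_ae ?_ h0
  filter_upwards [hcover] with y hy hTy using hy hTy

end IsDualPair

/-! ### Atoms of the minimizer and of its coordinates. -/

namespace IsParam

variable {G : Set (ℝ × ℝ)} {g : ℝ → ℝ × ℝ}

theorem exists_fst_lt_lt (h : IsParam G g) {p : ℝ × ℝ} (hp : p ∈ G)
    (hv : ∀ x ∈ G, x.1 = p.1 → x = p) : p.1 ∈ fstRange G := by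
  have e := h.apply_sum hp
  constructor
  · refine ⟨g (p.1 + p.2 - 1), h.mem _, ?_⟩
    have h1 := h.mono (show p.1 + p.2 - 1 ≤ p.1 + p.2 by linarith)
    rw [e] at h1
    refine lt_of_le_of_ne h1.1 fun h2 => ?_
    have h3 := h.sum (p.1 + p.2 - 1)
    rw [hv _ (h.mem _) h2] at h3
    linarith
  · refine ⟨g (p.1 + p.2 + 1), h.mem _, ?_⟩
    have h1 := h.mono (show p.1 + p.2 ≤ p.1 + p.2 + 1 by linarith)
    rw [e] at h1
    refine lt_of_le_of_ne h1.1 fun h2 => ?_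
    have h3 := h.sum (p.1 + p.2 + 1)
    rw [hv _ (h.mem _) h2.symm] at h3
    linarith

theorem exists_snd_lt_lt (h : IsParam G g) {p : ℝ × ℝ} (hp : p ∈ G)
    (hv : ∀ x ∈ G, x.2 = p.2 → x = p) : (∃ r ∈ G, r.2 < p.2) ∧ ∃ r ∈ G, p.2 < r.2 := by
  obtain ⟨g', h'⟩ := h.isMaximalMonotone.swap.exists_isParam
  obtain ⟨⟨r, hr, h1⟩, s, hs, h2⟩ := h'.exists_fst_lt_lt (p := p.swap) (by simpa)
    (fun x hx hx1 => by rw [← hv x.swap hx hx1, Prod.swap_swap])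
  exact ⟨⟨r.swap, hr, h1⟩, s.swap, hs, h2⟩

/-- A tangent direction of `G` at `p` from above bounds the set of the points whose minimizer
is `p`. -/
theorem exists_tangent (h : IsParam G g) {p : ℝ × ℝ} (hp : p ∈ G) :
    ∃ u ∈ Icc (0 : ℝ) 1, ∀ y, IsArgmin G y p → 0 ≤ u * (p.1 - y.1) + (1 - u) * (p.2 - y.2) := by
  set τ : ℕ → ℝ := fun n => 1 / ((n : ℝ) + 1) with hτ
  have hτ0 : ∀ n, 0 < τ n := fun n => by positivity
  have hτlim : Tendsto τ atTop (𝓝 0) := tendsto_one_div_add_atTop_nhds_zero_nat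
  set x : ℕ → ℝ × ℝ := fun n => g (p.1 + p.2 + τ n) with hx
  have hpx : ∀ n, p ≤ x n := fun n => by
    have := h.mono (show p.1 + p.2 ≤ p.1 + p.2 + τ n by linarith [hτ0 n])
    rwa [h.apply_sum hp] at this
  have hsum : ∀ n, (x n).1 + (x n).2 = p.1 + p.2 + τ n := fun n => h.sum _
  set θ : ℕ → ℝ := fun n => ((x n).2 - p.2) / τ n with hθ
  have hθmem : ∀ n, θ n ∈ Icc (0 : ℝ) 1 := fun n => by
    have h1 := (hpx n).1
    have h2 := (hpx n).2
    have h3 := hsum n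
    refine ⟨div_nonneg (by linarith) (hτ0 n).le, ?_⟩
    simp only [hθ]
    rw [div_le_one (hτ0 n)]; linarith
  obtain ⟨u, hu, k, hk, hlim⟩ := isCompact_Icc.tendsto_subseq hθmem
  refine ⟨u, hu, fun y hy => ?_⟩
  -- This is the inequality `c(p, y) ≤ c(x n, y)` divided by `τ n`, where `x n - p = τ n (1 - θ n, θ
  -- n)`; the last term is the quadratic remainder and vanishes in the limit.
  have hineq : ∀ n, 0 ≤ θ n * (p.1 - y.1) + (1 - θ n) * (p.2 - y.2) + θ n * (1 - θ n) * τ n := by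
    intro n
    have h1 := hy.2 (x n) (h.mem _)
    have e2 : (x n).2 = p.2 + θ n * τ n := by
      simp only [hθ]; rw [div_mul_cancel₀ _ (hτ0 n).ne']; ring
    have e1 : (x n).1 = p.1 + (1 - θ n) * τ n := by linarith [hsum n]
    unfold cost at h1
    rw [e1, e2] at h1
    have : 0 ≤ τ n * (θ n * (p.1 - y.1) + (1 - θ n) * (p.2 - y.2) + θ n * (1 - θ n) * τ n) := by
      nlinarith
    exact nonneg_of_mul_nonneg_right this (hτ0 n)
  have hτk := hτlim.comp hk.tendsto_atTop
  have hl : Tendsto (fun n => θ (k n) * (p.1 - y.1) + (1 - θ (k n)) * (p.2 - y.2) +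
      θ (k n) * (1 - θ (k n)) * τ (k n)) atTop
      (𝓝 (u * (p.1 - y.1) + (1 - u) * (p.2 - y.2) + u * (1 - u) * 0)) :=
    ((hlim.mul_const _).add ((hlim.const_sub 1).mul_const _)).add
      ((hlim.mul (hlim.const_sub 1)).mul hτk)
  have := ge_of_tendsto' hl (fun n => hineq (k n))
  linarith

end IsParam

/-- Lines with direction in the open fourth quadrant or parallel to an axis are null sets. -/
theorem IsDRegular.measure_line {ν : Measure (ℝ × ℝ)} (hν : IsDRegular ν)
    [NullSingletonClass (ν.map Prod.fst)] [NullSingletonClass (ν.map Prod.snd)] {u : ℝ}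
    (hu : u ∈ Icc (0 : ℝ) 1) (p : ℝ × ℝ) :
    ∀ᵐ y ∂ν, u * (p.1 - y.1) + (1 - u) * (p.2 - y.2) ≠ 0 := by
  have hsing : ∀ a : ℝ, ({a} : Set ℝ).Subsingleton := fun a => subsingleton_singleton
  rcases hu.1.eq_or_lt with rfl | h0
  · filter_upwards [ae_notMem_of_subsingleton (ν := ν) measurable_snd (hsing p.2)] with y hy h1
    exact hy (by simp only [mem_singleton_iff]; linarith)
  rcases hu.2.eq_or_lt with rfl | h1
  · filter_upwards [ae_notMem_of_subsingleton (ν := ν) measurable_fst (hsing p.1)] with y hy h1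
    exact hy (by simp only [mem_singleton_iff]; linarith)
  have hu1 : 0 < 1 - u := by linarith
  have : ν {y | u * (p.1 - y.1) + (1 - u) * (p.2 - y.2) = 0} = 0 := by
    set K := max 1 (max (u / (1 - u)) ((1 - u) / u)) with hK
    have hK1 : 1 ≤ K := le_max_left _ _
    have hK2 : u / (1 - u) ≤ K := (le_max_left _ _).trans (le_max_right _ _)
    have hK3 : (1 - u) / u ≤ K := (le_max_right _ _).trans (le_max_right _ _)
    have hK0 : 0 < K := by linarith
    refine hν.measure_eq_zero hK1 fun y hy z hz hyz => ?_
    have e : y.2 - z.2 = u / (1 - u) * (z.1 - y.1) := by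
      simp only [mem_ofPred_eq] at hy hz
      rw [div_mul_eq_mul_div, eq_div_iff hu1.ne']
      linarith
    have hd : 0 ≤ z.1 - y.1 := by linarith
    rw [e]
    refine ⟨mul_le_mul_of_nonneg_right ?_ hd, mul_le_mul_of_nonneg_right hK2 hd⟩
    rw [div_le_iff₀ h0] at hK3
    rw [div_le_div_iff₀ hK0 hu1]
    linarith
  exact measure_eq_zero_iff_ae_notMem.1 this

theorem measure_eq_zero_of_setIntegral_eq_zero {α : Type*} [MeasurableSpace α] {ν : Measure α}
    {A : Set α} (hA : MeasurableSet A) {f : α → ℝ} (hf : Integrable f ν)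
    (hpos : ∀ᵐ y ∂ν, y ∈ A → 0 < f y) (h0 : ∫ y in A, f y ∂ν = 0) : ν A = 0 := by
  have h1 : 0 ≤ᵐ[ν.restrict A] f := by
    rw [EventuallyLE, ae_restrict_iff' hA]
    filter_upwards [hpos] with y hy hyA using (hy hyA).le
  have h2 := (setIntegral_eq_zero_iff_of_nonneg_ae h1 hf.integrableOn).1 h0
  rw [EventuallyEq, ae_restrict_iff' hA] at h2
  rw [measure_eq_zero_iff_ae_notMem]
  filter_upwards [h2, hpos] with y hy2 hy hyA
  have := hy hyA
  rw [hy2 hyA] at this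
  exact lt_irrefl _ this

namespace IsDualPair

variable {ν : Measure (ℝ × ℝ)} {G : Set (ℝ × ℝ)} {T : ℝ × ℝ → ℝ × ℝ}

theorem integrable_fst [IsProbabilityMeasure ν] (h : IsDualPair ν G T) :
    Integrable (fun y => y.1) ν := h.memLp_fst.integrable (by norm_num)

/-- If the vertical slice of `G` through `p` is trivial, then the mean of `y₂` over the points with
the minimizer `p` is `p₂`. -/
theorem setIntegral_snd_fiber [IsProbabilityMeasure ν] (h : IsDualPair ν G T) {p : ℝ × ℝ}
    (hp : p ∈ G) (hv : ∀ x ∈ G, x.1 = p.1 → x = p) : ∫ y in {y | T y = p}, (p.2 - y.2) ∂ν = 0 := by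
  obtain ⟨g, hg⟩ := h.isDualMaximizer.1.exists_isParam
  rw [← h.setIntegral_fst_eq (hg.exists_fst_lt_lt hp hv)]
  have : ({y | (T y).1 = p.1} : Set (ℝ × ℝ)) =ᵐ[ν] {y | T y = p} := by
    filter_upwards [h.ae_isStrictArgmin] with y hy
    exact propext ⟨fun h1 => hv _ hy.1 h1, fun h1 => congrArg Prod.fst h1⟩
  rw [setIntegral_congr_set this]
  refine setIntegral_congr_fun (h.measurable (measurableSet_singleton p)) fun y hy => ?_
  rw [show T y = p from hy]

theorem setIntegral_fst_fiber [IsProbabilityMeasure ν] (h : IsDualPair ν G T) {p : ℝ × ℝ}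
    (hp : p ∈ G) (hv : ∀ x ∈ G, x.2 = p.2 → x = p) : ∫ y in {y | T y = p}, (p.1 - y.1) ∂ν = 0 := by
  obtain ⟨g, hg⟩ := h.isDualMaximizer.1.exists_isParam
  rw [← h.setIntegral_snd_eq (hg.exists_snd_lt_lt hp hv)]
  have : ({y | (T y).2 = p.2} : Set (ℝ × ℝ)) =ᵐ[ν] {y | T y = p} := by
    filter_upwards [h.ae_isStrictArgmin] with y hy
    exact propext ⟨fun h1 => hv _ hy.1 h1, fun h1 => congrArg Prod.snd h1⟩
  rw [setIntegral_congr_set this]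
  refine setIntegral_congr_fun (h.measurable (measurableSet_singleton p)) fun y hy => ?_
  rw [show T y = p from hy]

theorem measurableSet_fiber (h : IsDualPair ν G T) (p : ℝ × ℝ) : MeasurableSet {y | T y = p} :=
  h.measurable (measurableSet_singleton p)

/-- Comparing `p` strictly with `q` on the same vertical line gives `(q₂ - p₂)(p₁ - y₁) > 0` on the
fiber, while its integral there is zero by the first variation. -/
theorem measure_fiber_of_trivial_horizontal [IsProbabilityMeasure ν] (h : IsDualPair ν G T)
    {p q : ℝ × ℝ} (hp : p ∈ G) (hv : ∀ x ∈ G, x.2 = p.2 → x = p) (hq : q ∈ G) (hqp : q.1 = p.1)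
    (hne : q ≠ p) : ν {y | T y = p} = 0 := by
  have h0 := h.setIntegral_fst_fiber hp hv
  refine measure_eq_zero_of_setIntegral_eq_zero (h.measurableSet_fiber p)
    (f := fun y => (q.2 - p.2) * (p.1 - y.1)) ?_ ?_ ?_
  · exact ((integrable_const _).sub h.integrable_fst).const_mul _
  · filter_upwards [h.ae_isStrictArgmin] with y hy hyp
    have hyp : T y = p := hyp
    rw [hyp] at hy
    have := hy.2 q hq hne
    unfold cost at this
    rw [hqp] at this
    nlinarith
  · rw [integral_const_mul, h0, mul_zero]

theorem measure_fiber_swap (h : IsDualPair ν G T) (p : ℝ × ℝ) :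
    (ν.map Prod.swap) {y | (Prod.swap ∘ T ∘ Prod.swap) y = p.swap} = ν {y | T y = p} := by
  rw [Measure.map_apply measurable_swap (h.swap.measurableSet_fiber _)]
  congr 1
  ext y
  simp only [mem_preimage, mem_ofPred_eq, Function.comp_apply, Prod.swap_swap]
  exact Prod.swap_injective.eq_iff

/-- The minimizer has no atoms. -/
theorem measure_fiber [IsProbabilityMeasure ν] (h : IsDualPair ν G T) (hν : IsDRegular ν)
    [NullSingletonClass (ν.map Prod.fst)] [NullSingletonClass (ν.map Prod.snd)] {p : ℝ × ℝ}
    (hp : p ∈ G) : ν {y | T y = p} = 0 := by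
  have hprob : IsProbabilityMeasure (ν.map Prod.swap) :=
    Measure.isProbabilityMeasure_map measurable_swap.aemeasurable
  obtain ⟨g, hg⟩ := h.isDualMaximizer.1.exists_isParam
  by_cases hV : ∀ x ∈ G, x.1 = p.1 → x = p
  · by_cases hH : ∀ x ∈ G, x.2 = p.2 → x = p
    -- Both coordinates have the right mean on the fiber, which lies in a half-plane with `p` on its
    -- boundary line. That line is null, so the fiber is null.
    · obtain ⟨u, hu, htan⟩ := hg.exists_tangent hp
      have h1 := h.setIntegral_fst_fiber hp hH
      have h2 := h.setIntegral_snd_fiber hp hV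
      have i1 : Integrable (fun y : ℝ × ℝ => p.1 - y.1) ν :=
        (integrable_const _).sub h.integrable_fst
      have i2 : Integrable (fun y : ℝ × ℝ => p.2 - y.2) ν :=
        (integrable_const _).sub h.integrable_snd
      refine measure_eq_zero_of_setIntegral_eq_zero (h.measurableSet_fiber p)
        ((i1.const_mul u).add (i2.const_mul (1 - u))) ?_ ?_
      · filter_upwards [h.ae_isStrictArgmin, hν.measure_line hu p] with y hy hline hyp
        have hyp : T y = p := hyp
        rw [hyp] at hy
        exact lt_of_le_of_ne (htan y hy.isArgmin) (Ne.symm hline)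
      · simp only [Pi.add_apply]
        rw [integral_add (i1.const_mul u).integrableOn (i2.const_mul (1 - u)).integrableOn,
          integral_const_mul, integral_const_mul, h1, h2]
        ring
    · push Not at hH
      obtain ⟨q, hq, hqp, hne⟩ := hH
      rw [← h.measure_fiber_swap]
      refine h.swap.measure_fiber_of_trivial_horizontal (q := q.swap) (by simpa) ?_ (by simpa) hqp
        (fun e => hne (Prod.swap_injective e))
      intro x hx hx2
      rw [← hV x.swap hx hx2, Prod.swap_swap]
  · by_cases hH : ∀ x ∈ G, x.2 = p.2 → x = p
    · push Not at hV
      obtain ⟨q, hq, hqp, hne⟩ := hV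
      exact h.measure_fiber_of_trivial_horizontal hp hH hq hqp hne
    · push Not at hV hH
      obtain ⟨⟨a', d⟩, hq, rfl, hne⟩ := hV
      obtain ⟨⟨e, b'⟩, hr, rfl, hne'⟩ := hH
      obtain ⟨a, b⟩ := p
      simp only at hq hr hne hne'
      have hdb : d ≠ b := fun e => hne (by rw [e])
      have hea : e ≠ a := fun e => hne' (by rw [e])
      rcases lt_or_gt_of_ne hdb with h1 | h1
      · have : a < e := by
          rcases hg.le_or_ge hr hq with h3 | h3
          · exact absurd h3.2 (not_le_of_gt h1)
          · exact lt_of_le_of_ne h3.1 (Ne.symm hea)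
        exact h.measure_corner hp hq hr h1 this
      · have : e < a := by
          rcases hg.le_or_ge hr hq with h3 | h3
          · exact lt_of_le_of_ne h3.1 hea
          · exact absurd h3.2 (not_le_of_gt h1)
        rw [← h.measure_fiber_swap]
        exact h.swap.measure_corner (a := b) (b := a) (d := e) (e := d) hp hr hq this h1

/-- The first coordinate of the minimizer has no atoms. -/
theorem measure_fst_fiber (h : IsDualPair ν G T) [NullSingletonClass (ν.map Prod.fst)]
    (hatom : ∀ p ∈ G, ν {y | T y = p} = 0) (a : ℝ) :
    ν {y | (T y).1 = a} = 0 := by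
  -- For `y` strictly on one side of the line `x₁ = a`, the cost along that line is strictly
  -- monotone in `x₂`. Two points on the same side that are sent to the line thus share their
  -- minimizer, and its fiber is null.
  have key : ∀ R : ℝ × ℝ → Prop, (∀ y y', R y → R y' → 0 < (y.1 - a) * (y'.1 - a)) →
      ∀ᵐ y ∂ν, R y → (T y).1 ≠ a := by
    intro R hR
    by_cases hex : ∃ y, IsStrictArgmin G y (T y) ∧ R y ∧ (T y).1 = a
    · obtain ⟨y₀, hy₀, hR₀, ha₀⟩ := hex
      filter_upwards [h.ae_isStrictArgmin,
        measure_eq_zero_iff_ae_notMem.1 (hatom _ hy₀.1)] with y hy hne hRy hay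
      have h3 : T y ≠ T y₀ := hne
      have h1 := hy.2 _ hy₀.1 h3.symm
      have h2 := hy₀.2 _ hy.1 h3
      have h4 := hR _ _ hRy hR₀
      unfold cost at h1 h2
      rw [ha₀, hay] at h1 h2
      have h5 : 0 < (y.1 - a) * ((T y).2 - (T y₀).2) := by nlinarith
      have h6 : 0 < (y₀.1 - a) * ((T y₀).2 - (T y).2) := by nlinarith
      have h7 := mul_pos h5 h6
      nlinarith [mul_nonneg h4.le (sq_nonneg ((T y).2 - (T y₀).2))]
    · push Not at hex
      filter_upwards [h.ae_isStrictArgmin] with y hy hRy using hex y hy hRy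
  rw [measure_eq_zero_iff_ae_notMem]
  filter_upwards [key (fun y => a < y.1) (fun y y' h1 h2 => mul_pos (by linarith) (by linarith)),
    key (fun y => y.1 < a) (fun y y' h1 h2 => mul_pos_of_neg_of_neg (by linarith) (by linarith)),
    ae_notMem_of_subsingleton (ν := ν) measurable_fst (subsingleton_singleton (a := a))]
    with y h1 h2 h3 h4
  rcases lt_trichotomy y.1 a with h5 | h5 | h5
  · exact h2 h5 h4
  · exact h3 h5
  · exact h1 h5 h4

theorem measure_fst_fiber_swap (h : IsDualPair ν G T) (b : ℝ) :
    (ν.map Prod.swap) {y | ((Prod.swap ∘ T ∘ Prod.swap) y).1 = b} = ν {y | (T y).2 = b} := by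
  have hm : MeasurableSet {y | ((Prod.swap ∘ T ∘ Prod.swap) y).1 = b} :=
    h.swap.measurable.fst (measurableSet_singleton b)
  rw [Measure.map_apply measurable_swap hm]
  rfl

/-- The second coordinate of the minimizer has no atoms. -/
theorem measure_snd_fiber (h : IsDualPair ν G T) [hs : NullSingletonClass (ν.map Prod.snd)]
    (hatom : ∀ p ∈ G, ν {y | T y = p} = 0) (b : ℝ) :
    ν {y | (T y).2 = b} = 0 := by
  have : NullSingletonClass ((ν.map Prod.swap).map Prod.fst) := by
    rw [Measure.map_map measurable_fst measurable_swap]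
    exact hs
  have h1 := h.swap.measure_fst_fiber (fun p hp => by
    have := h.measure_fiber_swap p.swap
    rw [Prod.swap_swap] at this
    rw [this]
    exact hatom _ hp) b
  rwa [h.measure_fst_fiber_swap] at h1

end IsDualPair

/-! ### The martingale property of the minimizer. -/

/-- The first coordinates of the vertical segments of `G`. -/
def verticals (G : Set (ℝ × ℝ)) : Set ℝ := ⋃ c : ℚ, verticalCrossings G c

theorem IsMonotoneSet.countable_verticals {G : Set (ℝ × ℝ)} (hG : IsMonotoneSet G) :
    (verticals G).Countable :=
  countable_iUnion fun c => (hG.subsingleton_verticalCrossings c).countable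

theorem eq_of_notMem_verticals {G : Set (ℝ × ℝ)} {x z : ℝ × ℝ} (hx : x ∈ G) (hz : z ∈ G)
    (hxz : x.1 = z.1) (hn : x.1 ∉ verticals G) : x = z := by
  refine Prod.ext hxz ?_
  by_contra hne
  refine hn (mem_iUnion.2 ?_)
  rcases lt_or_gt_of_ne hne with h | h
  · obtain ⟨c, h1, h2⟩ := exists_rat_btwn h
    exact ⟨c, x.2, z.2, hx, by rw [hxz]; exact hz, h1, h2⟩
  · obtain ⟨c, h1, h2⟩ := exists_rat_btwn h
    exact ⟨c, z.2, x.2, by rw [hxz]; exact hz, hx, h1, h2⟩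

theorem ae_notMem_of_countable {α β : Type*} [MeasurableSpace α] {ν : Measure α} {f : α → β}
    (hf : ∀ b, ν {y | f y = b} = 0) {S : Set β} (hS : S.Countable) : ∀ᵐ y ∂ν, f y ∉ S := by
  refine measure_eq_zero_iff_ae_notMem (s := {y | f y ∈ S}) |>.1 ?_
  have : {y | f y ∈ S} = ⋃ b ∈ S, {y | f y = b} := by ext y; simp
  rw [this, measure_biUnion_null_iff hS]
  exact fun b _ => hf b

namespace IsDualPair

variable {ν : Measure (ℝ × ℝ)} {G : Set (ℝ × ℝ)} {T : ℝ × ℝ → ℝ × ℝ}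

/-- The only abscissas of `G` outside the open interval are a possible least and a possible greatest
one, and single values are null. -/
theorem ae_fst_mem_fstRange (h : IsDualPair ν G T) (hfib : ∀ a, ν {y | (T y).1 = a} = 0) :
    ∀ᵐ y ∂ν, (T y).1 ∈ fstRange G := by
  have h1 : {t | (∃ x ∈ G, x.1 = t) ∧ ∀ r ∈ G, t ≤ r.1}.Subsingleton := by
    rintro s ⟨⟨x, hx, rfl⟩, hs⟩ t ⟨⟨z, hz, rfl⟩, ht⟩
    exact le_antisymm (hs z hz) (ht x hx)
  have h2 : {t | (∃ x ∈ G, x.1 = t) ∧ ∀ r ∈ G, r.1 ≤ t}.Subsingleton := by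
    rintro s ⟨⟨x, hx, rfl⟩, hs⟩ t ⟨⟨z, hz, rfl⟩, ht⟩
    exact le_antisymm (ht x hx) (hs z hz)
  filter_upwards [h.ae_isStrictArgmin, ae_notMem_of_countable hfib h1.countable,
    ae_notMem_of_countable hfib h2.countable] with y hy hy1 hy2
  constructor
  · by_contra! hc
    exact hy1 ⟨⟨_, hy.1, rfl⟩, hc⟩
  · by_contra! hc
    exact hy2 ⟨⟨_, hy.1, rfl⟩, hc⟩

/-- Up to null sets, the events generated by the minimizer are generated by its first
coordinate. -/
theorem exists_preimage_fst (h : IsDualPair ν G T) (hfib : ∀ a, ν {y | (T y).1 = a} = 0) {B : Set (ℝ × ℝ)}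
    (hB : MeasurableSet B) :
    ∃ B' : Set ℝ, MeasurableSet B' ∧ ∀ᵐ y ∂ν, (T y).1 ∈ B' ↔ T y ∈ B := by
  obtain ⟨g, hg⟩ := h.isDualMaximizer.1.exists_isParam
  have hc := hg.isMaximalMonotone.1.countable_verticals
  refine ⟨Prod.fst '' (B ∩ (G \ Prod.fst ⁻¹' verticals G)), ?_, ?_⟩
  -- Off the vertical segments the first projection is injective on `G`, so it maps this Borel set
  -- to a Borel set.
  · refine (hB.inter (hg.isClosed.measurableSet.diff
      (measurable_fst hc.measurableSet))).image_of_continuousOn_injOn continuous_fst.continuousOn ?_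
    rintro x ⟨-, hx, hxv⟩ z ⟨-, hz, -⟩ hxz
    exact eq_of_notMem_verticals hx hz hxz hxv
  · filter_upwards [h.ae_isStrictArgmin, ae_notMem_of_countable hfib hc] with y hy hyv
    constructor
    · rintro ⟨x, ⟨hxB, hx, hxv⟩, hxT⟩
      rwa [← eq_of_notMem_verticals hx hy.1 hxT hxv]
    · exact fun hyB => ⟨T y, ⟨hyB, hy.1, hyv⟩, rfl⟩

section

variable [IsProbabilityMeasure ν]

theorem setIntegral_preimage (h : IsDualPair ν G T) (hfib : ∀ a, ν {y | (T y).1 = a} = 0) {l r : ℝ}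
    (hl : l ∈ fstRange G) (hr : r ∈ fstRange G) {B : Set (ℝ × ℝ)} (hB : MeasurableSet B) :
    ∫ y in {y | T y ∈ B ∧ (T y).1 ∈ Ioo l r}, ((T y).2 - y.2) ∂ν = 0 := by
  obtain ⟨B', hB', hBB'⟩ := h.exists_preimage_fst hfib hB
  rw [← h.setIntegral_fst_preimage hl hr (hB'.inter measurableSet_Ioo) inter_subset_right]
  refine setIntegral_congr_set ?_
  filter_upwards [hBB'] with y hy
  exact propext ⟨fun h1 => ⟨hy.2 h1.1, h1.2⟩, fun h1 => ⟨hy.1 h1.1, h1.2⟩⟩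

/-- The identity is proved on the events that `X₁` lies in a rational interval, where `X₂` is
bounded, and these countably many events cover almost everything. -/
theorem snd_ae_eq_condExp (h : IsDualPair ν G T) (hfib : ∀ a, ν {y | (T y).1 = a} = 0) :
    (fun y => (T y).2) =ᵐ[ν] ν[fun y => y.2 | MeasurableSpace.comap T inferInstance] := by
  have hm : MeasurableSpace.comap T inferInstance ≤ (inferInstance : MeasurableSpace (ℝ × ℝ)) :=
    h.measurable.comap_le
  have hT : Measurable[MeasurableSpace.comap T inferInstance] T := comap_measurable T
  have key : ∀ l r : ℚ, (l : ℝ) ∈ fstRange G → (r : ℝ) ∈ fstRange G → ∀ᵐ y ∂ν,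
      (T y).1 ∈ Ioo (l : ℝ) r →
        (T y).2 = (ν[fun y => y.2 | MeasurableSpace.comap T inferInstance]) y := by
    intro l r hl hr
    set I : Set (ℝ × ℝ) := T ⁻¹' (Prod.fst ⁻¹' Ioo (l : ℝ) r) with hI
    have hIm : MeasurableSet[MeasurableSpace.comap T inferInstance] I :=
      ⟨_, measurable_fst measurableSet_Ioo, rfl⟩
    have hW : Integrable (I.indicator fun y => (T y).2) ν :=
      (h.integrableOn_snd hl hr (hm _ hIm) fun y hy => Ioo_subset_Icc_self hy).integrable_indicator
        (hm _ hIm)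
    have h1 : I.indicator (fun y => (T y).2) =ᵐ[ν]
        ν[I.indicator (fun y => y.2) | MeasurableSpace.comap T inferInstance] := by
      refine ae_eq_condExp_of_forall_setIntegral_eq hm
        (h.integrable_snd.indicator (hm _ hIm)) (fun s _ _ => hW.integrableOn) ?_ ?_
      · rintro _ ⟨B, hB, rfl⟩ -
        rw [← sub_eq_zero, ← integral_sub hW.integrableOn
          (h.integrable_snd.indicator (hm _ hIm)).integrableOn,
          ← h.setIntegral_preimage hfib hl hr hB]
        have : {y | T y ∈ B ∧ (T y).1 ∈ Ioo (l : ℝ) r} = T ⁻¹' B ∩ I := rfl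
        rw [this, ← setIntegral_indicator (hm _ hIm)]
        refine integral_congr_ae (Eventually.of_forall fun y => ?_)
        by_cases hy : y ∈ I
        · simp only [indicator_of_mem hy]
        · simp only [indicator_of_notMem hy, sub_zero]
      · exact (hT.snd.indicator hIm).stronglyMeasurable.aestronglyMeasurable
    filter_upwards [h1, condExp_indicator (m := MeasurableSpace.comap T inferInstance)
      h.integrable_snd hIm] with y hy1 hy2 hyI
    have hyI' : y ∈ I := hyI
    rw [hy2, indicator_of_mem hyI', indicator_of_mem hyI'] at hy1
    exact hy1
  have key' : ∀ᵐ y ∂ν, ∀ l r : ℚ, (l : ℝ) ∈ fstRange G → (r : ℝ) ∈ fstRange G →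
      (T y).1 ∈ Ioo (l : ℝ) r →
        (T y).2 = (ν[fun y => y.2 | MeasurableSpace.comap T inferInstance]) y := by
    simpa only [ae_all_iff] using key
  filter_upwards [key', h.ae_fst_mem_fstRange hfib] with y hy hyr
  obtain ⟨l, r, hl, hr, hlr⟩ := exists_Ioo_of_mem_fstRange hyr
  exact hy l r hl hr hlr

/-- Square integrability of `X₂` is a consequence of the martingale identity, as conditional
expectation preserves `L²`. -/
theorem memLp_map_snd (h : IsDualPair ν G T) (hfib : ∀ a, ν {y | (T y).1 = a} = 0) :
    MemLp (fun y => (T y).2) 2 ν :=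
  (memLp_congr_ae (h.snd_ae_eq_condExp hfib)).2 (h.memLp_snd.condExp (by norm_num))

theorem setIntegral_snd (h : IsDualPair ν G T) (hfib : ∀ a, ν {y | (T y).1 = a} = 0) {B : Set (ℝ × ℝ)}
    (hB : MeasurableSet B) : ∫ y in T ⁻¹' B, (T y).2 ∂ν = ∫ y in T ⁻¹' B, y.2 ∂ν := by
  rw [← setIntegral_condExp h.measurable.comap_le h.integrable_snd ⟨B, hB, rfl⟩]
  exact integral_congr_ae (ae_restrict_of_ae (h.snd_ae_eq_condExp hfib))

theorem memLp_map_fst (h : IsDualPair ν G T) (hfib : ∀ b, ν {y | (T y).2 = b} = 0) :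
    MemLp (fun y => (T y).1) 2 ν := by
  have : IsProbabilityMeasure (ν.map Prod.swap) :=
    Measure.isProbabilityMeasure_map measurable_swap.aemeasurable
  have h1 := h.swap.memLp_map_snd (fun b => by
    rw [h.measure_fst_fiber_swap]
    exact hfib b)
  rw [memLp_map_measure_iff h.swap.measurable.snd.aestronglyMeasurable
    measurable_swap.aemeasurable] at h1
  exact h1

theorem setIntegral_fst (h : IsDualPair ν G T) (hfib : ∀ b, ν {y | (T y).2 = b} = 0)
    {B : Set (ℝ × ℝ)} (hB : MeasurableSet B) :
    ∫ y in T ⁻¹' B, (T y).1 ∂ν = ∫ y in T ⁻¹' B, y.1 ∂ν := by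
  have : IsProbabilityMeasure (ν.map Prod.swap) :=
    Measure.isProbabilityMeasure_map measurable_swap.aemeasurable
  have h1 := h.swap.setIntegral_snd (fun b => by
    rw [h.measure_fst_fiber_swap]
    exact hfib b) (measurable_swap hB)
  have e := (MeasurableEquiv.prodComm (α := ℝ) (β := ℝ)).measurableEmbedding
  have h2 := e.setIntegral_map (μ := ν) (fun y => ((Prod.swap ∘ T ∘ Prod.swap) y).2)
    ((Prod.swap ∘ T ∘ Prod.swap) ⁻¹' (Prod.swap ⁻¹' B))
  have h3 := e.setIntegral_map (μ := ν) (fun y => y.2)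
    ((Prod.swap ∘ T ∘ Prod.swap) ⁻¹' (Prod.swap ⁻¹' B))
  exact h2.symm.trans (h1.trans h3)

end

end IsDualPair

/-! ### Plans, weak duality and complementary slackness. -/

/-- The martingale property `E[V | U] = U` in terms of integrals over the events of `U`. -/
theorem condExp_comap_eq_iff {Ω : Type*} [MeasurableSpace Ω] {P : Measure Ω} [IsFiniteMeasure P]
    {E : Type*} [NormedAddCommGroup E] [NormedSpace ℝ E] [CompleteSpace E]
    [SecondCountableTopology E] [MeasurableSpace E] [BorelSpace E] {U V : Ω → E}
    (hUm : Measurable U) (hU : Integrable U P) (hV : Integrable V P) :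
    P[V | MeasurableSpace.comap U inferInstance] =ᵐ[P] U ↔
      ∀ B, MeasurableSet B → ∫ ω in U ⁻¹' B, V ω ∂P = ∫ ω in U ⁻¹' B, U ω ∂P := by
  constructor
  · intro h B hB
    rw [← setIntegral_condExp hUm.comap_le hV ⟨B, hB, rfl⟩]
    exact integral_congr_ae (ae_restrict_of_ae h)
  · intro h
    refine (ae_eq_condExp_of_forall_setIntegral_eq hUm.comap_le hV
      (fun s _ _ => hU.integrableOn) ?_ ?_).symm
    · rintro _ ⟨B, hB, rfl⟩ -
      exact (h B hB).symm
    · exact (comap_measurable U).stronglyMeasurable.aestronglyMeasurable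

theorem measurable_of_mem_martingaleMaps {Ω : Type*} [MeasurableSpace Ω] {P : Measure Ω}
    {Y X : Ω → ℝ × ℝ} (hY : Measurable Y) (hX : X ∈ martingaleMaps P Y) : Measurable X :=
  hX.1.mono hY.comap_le le_rfl

/-- The law of `(X, Y)` is a plan if `X` is a map. -/
theorem map_mem_martingalePlans {Ω : Type*} [MeasurableSpace Ω] {P : Measure Ω}
    [IsProbabilityMeasure P] {Y X : Ω → ℝ × ℝ} (hY : Measurable Y) (hY2 : MemLp Y 2 P)
    (hX : X ∈ martingaleMaps P Y) :
    P.map (fun ω => (X ω, Y ω)) ∈ martingalePlans (P.map Y) := by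
  have hXm := measurable_of_mem_martingaleMaps hY hX
  have hXY : Measurable fun ω => (X ω, Y ω) := hXm.prodMk hY
  have hprob : IsProbabilityMeasure (P.map fun ω => (X ω, Y ω)) :=
    Measure.isProbabilityMeasure_map hXY.aemeasurable
  have hXi : Integrable X P := hX.2.1.integrable (by norm_num)
  have hYi : Integrable Y P := hY2.integrable (by norm_num)
  refine ⟨hprob, ?_, ?_, ?_⟩
  · rw [memLp_map_measure_iff aestronglyMeasurable_id hXY.aemeasurable]
    exact MemLp.of_fst_snd ⟨hX.2.1, hY2⟩
  · rw [Measure.map_map measurable_snd hXY]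
    rfl
  · rw [condExp_comap_eq_iff measurable_fst]
    · intro B hB
      rw [setIntegral_map (measurable_fst hB) measurable_snd.aestronglyMeasurable
          hXY.aemeasurable,
        setIntegral_map (measurable_fst hB) measurable_fst.aestronglyMeasurable
          hXY.aemeasurable]
      exact (condExp_comap_eq_iff hXm hXi hYi).1 hX.2.2 B hB
    · rw [integrable_map_measure measurable_fst.aestronglyMeasurable hXY.aemeasurable]
      exact hXi
    · rw [integrable_map_measure measurable_snd.aestronglyMeasurable hXY.aemeasurable]
      exact hYi

section Plans

variable {ν : Measure (ℝ × ℝ)} {γ : Measure ((ℝ × ℝ) × (ℝ × ℝ))}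

theorem memLp_fst_of_mem_martingalePlans (hγ : γ ∈ martingalePlans ν) :
    MemLp (fun z : (ℝ × ℝ) × (ℝ × ℝ) => z.1) 2 γ := hγ.2.1.fst

theorem memLp_snd_of_mem_martingalePlans (hγ : γ ∈ martingalePlans ν) :
    MemLp (fun z : (ℝ × ℝ) × (ℝ × ℝ) => z.2) 2 γ := hγ.2.1.snd

/-- The martingale increment `y - x` is orthogonal to square integrable functions of `x`. -/
theorem integral_mul_eq_zero_of_mem_martingalePlans (hγ : γ ∈ martingalePlans ν)
    (ℓ : ℝ × ℝ →L[ℝ] ℝ) {t : ℝ × ℝ → ℝ} (ht : Measurable t) (ht2 : MemLp (fun z => t z.1) 2 γ) :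
    ∫ z, t z.1 * ℓ (z.2 - z.1) ∂γ = 0 := by
  have hprob : IsProbabilityMeasure γ := hγ.1
  have hx2 := memLp_fst_of_mem_martingalePlans hγ
  have hy2 := memLp_snd_of_mem_martingalePlans hγ
  have hx : Integrable (fun z : (ℝ × ℝ) × (ℝ × ℝ) => z.1) γ := hx2.integrable (by norm_num)
  have hy : Integrable (fun z : (ℝ × ℝ) × (ℝ × ℝ) => z.2) γ := hy2.integrable (by norm_num)
  have hset := (condExp_comap_eq_iff measurable_fst hx hy).1 hγ.2.2.2
  have hm : MeasurableSpace.comap (Prod.fst : (ℝ × ℝ) × (ℝ × ℝ) → ℝ × ℝ) inferInstance ≤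
      (inferInstance : MeasurableSpace ((ℝ × ℝ) × (ℝ × ℝ))) := measurable_fst.comap_le
  have hfm : Measurable[MeasurableSpace.comap (Prod.fst : (ℝ × ℝ) × (ℝ × ℝ) → ℝ × ℝ) inferInstance]
      (Prod.fst : (ℝ × ℝ) × (ℝ × ℝ) → ℝ × ℝ) := comap_measurable _
  have hℓx := ℓ.integrable_comp hx
  have hℓy := ℓ.integrable_comp hy
  have hcond : (fun z : (ℝ × ℝ) × (ℝ × ℝ) => ℓ z.1) =ᵐ[γ]
      γ[fun z => ℓ z.2 | MeasurableSpace.comap Prod.fst inferInstance] := by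
    refine ae_eq_condExp_of_forall_setIntegral_eq hm hℓy
      (fun s _ _ => hℓx.integrableOn) ?_ ?_
    · rintro _ ⟨B, hB, rfl⟩ -
      rw [ℓ.integral_comp_comm hx.integrableOn, ℓ.integral_comp_comm hy.integrableOn, hset B hB]
    · exact (ℓ.continuous.measurable.comp hfm).stronglyMeasurable.aestronglyMeasurable
  have hty : Integrable ((fun z : (ℝ × ℝ) × (ℝ × ℝ) => t z.1) * fun z => ℓ z.2) γ :=
    ht2.integrable_mul (ℓ.comp_memLp' hy2)
  have htx : Integrable ((fun z : (ℝ × ℝ) × (ℝ × ℝ) => t z.1) * fun z => ℓ z.1) γ :=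
    ht2.integrable_mul (ℓ.comp_memLp' hx2)
  have htm : StronglyMeasurable[MeasurableSpace.comap Prod.fst inferInstance]
      (fun z : (ℝ × ℝ) × (ℝ × ℝ) => t z.1) := (ht.comp hfm).stronglyMeasurable
  have h1 := condExp_mul_of_stronglyMeasurable_left htm hty hℓy
  have h2 : ∫ z, t z.1 * ℓ z.2 ∂γ = ∫ z, t z.1 * ℓ z.1 ∂γ := by
    have h3 := integral_condExp (f := (fun z : (ℝ × ℝ) × (ℝ × ℝ) => t z.1) * fun z => ℓ z.2)
      (μ := γ) hm
    refine h3.symm.trans (integral_congr_ae ?_)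
    filter_upwards [h1, hcond] with z hz1 hz2
    rw [hz1, Pi.mul_apply, ← hz2]
  have h3 : ∀ z : (ℝ × ℝ) × (ℝ × ℝ), t z.1 * ℓ (z.2 - z.1) = t z.1 * ℓ z.2 - t z.1 * ℓ z.1 := by
    intro z; rw [map_sub]; ring
  simp only [h3]
  have h4 := integral_sub hty htx
  simp only [Pi.mul_apply] at h4
  rw [h4, h2, sub_self]

theorem integrable_cost {α : Type*} [MeasurableSpace α] {μ : Measure α} {X Y : α → ℝ × ℝ}
    (hX : MemLp X 2 μ) (hY : MemLp Y 2 μ) : Integrable (fun a => cost (X a) (Y a)) μ := by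
  have h1 : MemLp (fun a => (X a).1 - (Y a).1) 2 μ := hX.fst.sub hY.fst
  have h2 : MemLp (fun a => (X a).2 - (Y a).2) 2 μ := hX.snd.sub hY.snd
  exact h1.integrable_mul h2

variable {G : Set (ℝ × ℝ)} {g : ℝ → ℝ × ℝ}

/-- The duality gap of a plan and a maximal monotone set. -/
theorem IsParam.integral_cost_eq (hg : IsParam G g) (hγ : γ ∈ martingalePlans ν)
    (hφ : Integrable (fun y => (phi G y).toReal) ν) :
    Integrable (fun z => cost (g (z.1.1 + z.1.2)) z.2 - (phi G z.2).toReal) γ ∧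
    Integrable (fun z => ((g (z.1.1 + z.1.2)).1 - z.1.1) ^ 2) γ ∧
    ∫ z, cost z.1 z.2 ∂γ = ∫ y, (phi G y).toReal ∂ν +
      (∫ z, (cost (g (z.1.1 + z.1.2)) z.2 - (phi G z.2).toReal) ∂γ +
      ∫ z, ((g (z.1.1 + z.1.2)).1 - z.1.1) ^ 2 ∂γ) := by
  have hprob : IsProbabilityMeasure γ := hγ.1
  have hx2 := memLp_fst_of_mem_martingalePlans hγ
  have hy2 := memLp_snd_of_mem_martingalePlans hγ
  set t : ℝ × ℝ → ℝ := fun x => (g (x.1 + x.2)).1 - x.1 with ht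
  have hgc := hg.continuous
  have htc : Continuous t := by simp only [ht]; fun_prop
  have ht2 : MemLp (fun z : (ℝ × ℝ) × (ℝ × ℝ) => t z.1) 2 γ := by
    have hx1 : MemLp (fun z : (ℝ × ℝ) × (ℝ × ℝ) => z.1.1) 2 γ := hx2.fst
    have hs : MemLp (fun z : (ℝ × ℝ) × (ℝ × ℝ) => z.1.1 + z.1.2) 2 γ := hx2.fst.add hx2.snd
    have hs1 : MemLp (fun z : (ℝ × ℝ) × (ℝ × ℝ) => ‖z.1.1 + z.1.2‖ + ‖z.1.1‖) 2 γ :=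
      hs.norm.add hx1.norm
    have hc : MemLp (fun _ : (ℝ × ℝ) × (ℝ × ℝ) => ‖(g 0).1‖) 2 γ := memLp_const _
    have hsum : MemLp
        (fun z : (ℝ × ℝ) × (ℝ × ℝ) => ‖(g 0).1‖ + (‖z.1.1 + z.1.2‖ + ‖z.1.1‖)) 2 γ := hc.add hs1
    refine hsum.mono (htc.comp continuous_fst).aestronglyMeasurable (Eventually.of_forall fun z => ?_)
    have h1 := hg.lipschitz_fst.dist_le_mul (z.1.1 + z.1.2) 0
    simp only [Real.dist_eq, NNReal.coe_one, one_mul, sub_zero] at h1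
    simp only [ht, Real.norm_eq_abs]
    rw [abs_of_nonneg (a := |(g 0).1| + _) (by positivity)]
    have h2 := abs_sub (g (z.1.1 + z.1.2)).1 z.1.1
    have h3 := abs_sub_abs_le_abs_sub (g (z.1.1 + z.1.2)).1 (g 0).1
    linarith
  have hzz2 : MemLp (fun z : (ℝ × ℝ) × (ℝ × ℝ) => g (z.1.1 + z.1.2)) 2 γ := by
    refine MemLp.of_fst_snd ⟨?_, ?_⟩
    · refine (ht2.add hx2.fst).ae_eq (Eventually.of_forall fun z => ?_)
      simp only [ht, Pi.add_apply]; ring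
    · refine (hx2.snd.sub ht2).ae_eq (Eventually.of_forall fun z => ?_)
      simp only [ht, Pi.sub_apply]; linarith [hg.sum (z.1.1 + z.1.2)]
  have hφγ : Integrable (fun z : (ℝ × ℝ) × (ℝ × ℝ) => (phi G z.2).toReal) γ := by
    rw [← hγ.2.2.1] at hφ
    exact hφ.comp_measurable measurable_snd
  have hφint : ∫ z, (phi G z.2).toReal ∂γ = ∫ y, (phi G y).toReal ∂ν := by
    rw [← hγ.2.2.1, integral_map measurable_snd.aemeasurable
      (measurable_phi G).ereal_toReal.aestronglyMeasurable]
  have hi1 := integrable_cost hzz2 hy2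
  have hi2 : Integrable (fun z : (ℝ × ℝ) × (ℝ × ℝ) => t z.1 ^ 2) γ := ht2.integrable_sq
  have hi3 : Integrable (fun z : (ℝ × ℝ) × (ℝ × ℝ) => t z.1 * (z.2 - z.1).2) γ :=
    ht2.integrable_mul (hy2.sub hx2).snd
  have hi4 : Integrable (fun z : (ℝ × ℝ) × (ℝ × ℝ) => t z.1 * (z.2 - z.1).1) γ :=
    ht2.integrable_mul (hy2.sub hx2).fst
  have hz3 : ∫ z, t z.1 * (z.2 - z.1).2 ∂γ = 0 :=
    integral_mul_eq_zero_of_mem_martingalePlans hγ (ContinuousLinearMap.snd ℝ ℝ ℝ) htc.measurable ht2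
  have hz4 : ∫ z, t z.1 * (z.2 - z.1).1 ∂γ = 0 :=
    integral_mul_eq_zero_of_mem_martingalePlans hγ (ContinuousLinearMap.fst ℝ ℝ ℝ) htc.measurable ht2
  refine ⟨hi1.sub hφγ, hi2, ?_⟩
  -- Moving `x` along its antidiagonal onto `G` changes the cost by the square of the displacement
  -- `t` and by terms linear in `y - x`, whose integrals vanish.
  have hcost : ∀ z : (ℝ × ℝ) × (ℝ × ℝ), cost z.1 z.2 = (cost (g (z.1.1 + z.1.2)) z.2 + t z.1 ^ 2) +
      (t z.1 * (z.2 - z.1).2 - t z.1 * (z.2 - z.1).1) := by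
    intro z
    have e : (g (z.1.1 + z.1.2)).2 = z.1.2 - t z.1 := by
      simp only [ht]; linarith [hg.sum (z.1.1 + z.1.2)]
    have e' : (g (z.1.1 + z.1.2)).1 = z.1.1 + t z.1 := by simp only [ht]; ring
    simp only [cost, e, e', Prod.fst_sub, Prod.snd_sub]
    ring
  simp only [hcost]
  have hadd := integral_add (hi1.add hi2) (hi3.sub hi4)
  simp only [Pi.add_apply, Pi.sub_apply] at hadd
  rw [hadd, integral_sub hi3 hi4, hz3, hz4,
    integral_add hi1 hi2, integral_sub hi1 hφγ, hφint]
  ring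

theorem IsParam.toReal_phi_le (hg : IsParam G g) {y : ℝ × ℝ} (hy : y ∈ phiDom G) {x : ℝ × ℝ}
    (hx : x ∈ G) : (phi G y).toReal ≤ cost x y := by
  have := phi_le_cost hx y
  rwa [← EReal.coe_toReal (hg.phi_ne_top y) hy, EReal.coe_le_coe_iff] at this

/-- Weak duality. -/
theorem IsParam.integral_phi_le (hg : IsParam G g) (hγ : γ ∈ martingalePlans ν)
    (hdom : ∀ᵐ y ∂ν, y ∈ phiDom G) (hφ : Integrable (fun y => (phi G y).toReal) ν) :
    ∫ y, (phi G y).toReal ∂ν ≤ ∫ z, cost z.1 z.2 ∂γ := by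
  obtain ⟨-, -, h⟩ := hg.integral_cost_eq hγ hφ
  rw [← hγ.2.2.1] at hdom
  have h1 : 0 ≤ ∫ z, (cost (g (z.1.1 + z.1.2)) z.2 - (phi G z.2).toReal) ∂γ :=
    integral_nonneg_of_ae (by
      filter_upwards [ae_of_ae_map measurable_snd.aemeasurable hdom] with z hz
      exact sub_nonneg.2 (hg.toReal_phi_le hz (hg.mem _)))
  have h2 : 0 ≤ ∫ z, ((g (z.1.1 + z.1.2)).1 - z.1.1) ^ 2 ∂γ :=
    integral_nonneg fun z => sq_nonneg _
  linarith

/-- Complementary slackness. -/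
theorem IsParam.ae_mem_of_integral_le (hg : IsParam G g) (hγ : γ ∈ martingalePlans ν)
    (hdom : ∀ᵐ y ∂ν, y ∈ phiDom G) (hφ : Integrable (fun y => (phi G y).toReal) ν)
    (hle : ∫ z, cost z.1 z.2 ∂γ ≤ ∫ y, (phi G y).toReal ∂ν) :
    ∀ᵐ z ∂γ, z.1 ∈ G ∧ cost z.1 z.2 = (phi G z.2).toReal := by
  obtain ⟨hi1, hi2, h⟩ := hg.integral_cost_eq hγ hφ
  rw [← hγ.2.2.1] at hdom
  have hn1 : 0 ≤ᵐ[γ] fun z => cost (g (z.1.1 + z.1.2)) z.2 - (phi G z.2).toReal := by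
    filter_upwards [ae_of_ae_map measurable_snd.aemeasurable hdom] with z hz
    exact sub_nonneg.2 (hg.toReal_phi_le hz (hg.mem _))
  have hn2 : 0 ≤ᵐ[γ] fun z => ((g (z.1.1 + z.1.2)).1 - z.1.1) ^ 2 :=
    Eventually.of_forall fun z => sq_nonneg _
  have h1 := integral_nonneg_of_ae hn1
  have h2 := integral_nonneg_of_ae hn2
  have e1 := (integral_eq_zero_iff_of_nonneg_ae hn1 hi1).1 (by linarith)
  have e2 := (integral_eq_zero_iff_of_nonneg_ae hn2 hi2).1 (by linarith)
  filter_upwards [e1, e2] with z hz1 hz2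
  have hz3 : (g (z.1.1 + z.1.2)).1 - z.1.1 = 0 := by
    simpa using hz2
  have hz4 : g (z.1.1 + z.1.2) = z.1 :=
    Prod.ext (by linarith) (by linarith [hg.sum (z.1.1 + z.1.2)])
  refine ⟨hz4 ▸ hg.mem _, ?_⟩
  simp only [hz4, Pi.zero_apply] at hz1
  linarith

end Plans

/-! ### Optimality, uniqueness and regularity of the minimizer map. -/

/-- A measurable version of `Dᶜφ_G`. -/
noncomputable def dualMap (G : Set (ℝ × ℝ)) (y : ℝ × ℝ) : ℝ × ℝ :=
  (y.1 - (interiorGrad G y).2, y.2 - (interiorGrad G y).1)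

theorem measurable_dualMap (G : Set (ℝ × ℝ)) : Measurable (dualMap G) :=
  (measurable_fst.sub (measurable_fderiv_apply_const ℝ _ _)).prodMk
    (measurable_snd.sub (measurable_fderiv_apply_const ℝ _ _))

theorem Dc_eq_dualMap {G : Set (ℝ × ℝ)} {y : ℝ × ℝ} (hy : y ∈ interior (phiDom G)) :
    Dc G y = dualMap G y := by
  simp only [Dc, dualMap, gradPhi, if_pos hy]

/-- A dual maximizer and its `Dᶜφ_G` form a dual pair. -/
theorem IsDualMaximizer.isDualPair {ν : Measure (ℝ × ℝ)} [NullSingletonClass (ν.map Prod.fst)]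
    [NullSingletonClass (ν.map Prod.snd)] {G : Set (ℝ × ℝ)} (hG : IsDualMaximizer ν G) (hL2 : MemLp id 2 ν)
    (hν : IsDRegular ν) : IsDualPair ν G (dualMap G) := by
  obtain ⟨g, hg⟩ := hG.1.exists_isParam
  have hrect := hg.ae_mem_rect (hG.ae_mem_phiDom hL2)
  refine ⟨hL2, hG, measurable_dualMap G, hrect, ?_⟩
  filter_upwards [hrect, hg.ae_exists_isStrictArgmin hν hrect] with y hy hp
  obtain ⟨p, hp⟩ := hp
  rwa [← Dc_eq_dualMap (hg.rect_subset_interior_phiDom hy), hp.Dc_eq hg hy]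

namespace IsDualPair

variable {ν : Measure (ℝ × ℝ)} {G : Set (ℝ × ℝ)} {T : ℝ × ℝ → ℝ × ℝ}

theorem ae_mem_gradDom (h : IsDualPair ν G T) : ∀ᵐ y ∂ν, y ∈ gradDom G := by
  obtain ⟨g, hg⟩ := h.isDualMaximizer.1.exists_isParam
  filter_upwards [h.ae_mem_rect, h.ae_isStrictArgmin] with y hy hp
  exact Or.inl (hp.mem_interiorGradDom hg hy)

theorem ae_eq_Dc (h : IsDualPair ν G T) : ∀ᵐ y ∂ν, T y = Dc G y := by
  obtain ⟨g, hg⟩ := h.isDualMaximizer.1.exists_isParam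
  filter_upwards [h.ae_mem_rect, h.ae_isStrictArgmin] with y hy hp
  exact (hp.Dc_eq hg hy).symm

theorem measure_fiber_eq_zero (h : IsDualPair ν G T) (hatom : ∀ p ∈ G, ν {y | T y = p} = 0)
    (p : ℝ × ℝ) : ν {y | T y = p} = 0 := by
  by_cases hp : p ∈ G
  · exact hatom p hp
  · rw [measure_eq_zero_iff_ae_notMem]
    filter_upwards [h.ae_isStrictArgmin] with y hy hyp
    have hyp : T y = p := hyp
    exact hp (hyp ▸ hy.1)

/-- A strictly decreasing graph meets the monotone set `G` in at most one point, and the law of the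
minimizer lives on `G` without atoms. -/
theorem isDRegular_map (h : IsDualPair ν G T) (hatom : ∀ p ∈ G, ν {y | T y = p} = 0) :
    IsDRegular (ν.map T) := by
  obtain ⟨g, hg⟩ := h.isDualMaximizer.1.exists_isParam
  rintro D ⟨I, f, K, -, -, -, hK, hf, rfl⟩
  set D : Set (ℝ × ℝ) := (fun t => (t, f t)) '' I
  have hsub : (D ∩ G).Subsingleton := by
    have key : ∀ s ∈ I, ∀ t ∈ I, (s, f s) ∈ G → (t, f t) ∈ G → ¬ s < t := by
      intro s hs t ht hsG htG hst
      have h1 := hg.isMaximalMonotone.1.le_of_fst_lt hsG htG hst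
      have h2 : 0 < 1 / K * (t - s) := mul_pos (by positivity) (by linarith)
      have h3 := (hf s hs t ht hst).1
      have h4 : f s ≤ f t := h1.2
      linarith
    rintro _ ⟨⟨s, hs, rfl⟩, hsG⟩ _ ⟨⟨t, ht, rfl⟩, htG⟩
    have : s = t := le_antisymm (not_lt.1 (key t ht s hs htG hsG)) (not_lt.1 (key s hs t ht hsG htG))
    rw [this]
  have h1 : (ν.map T) (D ∩ G) = 0 := by
    rcases hsub.eq_empty_or_singleton with he | ⟨p, hp⟩
    · rw [he, measure_empty]
    · rw [hp, Measure.map_apply h.measurable (measurableSet_singleton p)]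
      exact h.measure_fiber_eq_zero hatom p
  have h2 : (ν.map T) Gᶜ = 0 := by
    rw [Measure.map_apply h.measurable hg.isClosed.measurableSet.compl,
      measure_eq_zero_iff_ae_notMem]
    filter_upwards [h.ae_isStrictArgmin] with y hy hyG using hyG hy.1
  refine measure_mono_null (fun x hx => ?_) (measure_union_null h1 h2)
  by_cases hxG : x ∈ G
  · exact Or.inl ⟨hx, hxG⟩
  · exact Or.inr hxG

theorem memLp_map [IsProbabilityMeasure ν] (h : IsDualPair ν G T) (hfst : ∀ a, ν {y | (T y).1 = a} = 0)
    (hsnd : ∀ b, ν {y | (T y).2 = b} = 0) : MemLp T 2 ν :=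
  MemLp.of_fst_snd ⟨h.memLp_map_fst hsnd, h.memLp_map_snd hfst⟩

theorem setIntegral_map_eq [IsProbabilityMeasure ν] (h : IsDualPair ν G T) (hfst : ∀ a, ν {y | (T y).1 = a} = 0)
    (hsnd : ∀ b, ν {y | (T y).2 = b} = 0) {B : Set (ℝ × ℝ)} (hB : MeasurableSet B) :
    ∫ y in T ⁻¹' B, y ∂ν = ∫ y in T ⁻¹' B, T y ∂ν := by
  have h1 : Integrable T ν := (h.memLp_map hfst hsnd).integrable (by norm_num)
  have h2 : Integrable (fun y : ℝ × ℝ => y) ν := h.memLp.integrable (by norm_num)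
  refine Prod.ext ?_ ?_
  · rw [fst_integral h1.integrableOn, fst_integral h2.integrableOn]
    exact (h.setIntegral_fst hsnd hB).symm
  · rw [snd_integral h1.integrableOn, snd_integral h2.integrableOn]
    exact (h.setIntegral_snd hfst hB).symm

/-- The minimizer defines a map. -/
theorem comp_mem_martingaleMaps {Ω : Type*} [MeasurableSpace Ω] {P : Measure Ω}
    [IsProbabilityMeasure P] {Y : Ω → ℝ × ℝ} (hY : Measurable Y) (h : IsDualPair (P.map Y) G T)
    (hfst : ∀ a, P.map Y {y | (T y).1 = a} = 0) (hsnd : ∀ b, P.map Y {y | (T y).2 = b} = 0) :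
    T ∘ Y ∈ martingaleMaps P Y := by
  have hprob : IsProbabilityMeasure (P.map Y) := Measure.isProbabilityMeasure_map hY.aemeasurable
  have hT2 := h.memLp_map hfst hsnd
  have hX2 : MemLp (T ∘ Y) 2 P := hT2.comp_of_map hY.aemeasurable
  have hY2 : MemLp Y 2 P := h.memLp.comp_of_map hY.aemeasurable
  refine ⟨h.measurable.comp (comap_measurable Y), hX2, ?_⟩
  rw [condExp_comap_eq_iff (h.measurable.comp hY) (hX2.integrable (by norm_num))
    (hY2.integrable (by norm_num))]
  intro B hB
  have h1 := h.setIntegral_map_eq hfst hsnd hB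
  rw [setIntegral_map (f := fun y => y) (h.measurable hB) aestronglyMeasurable_id hY.aemeasurable,
    setIntegral_map (h.measurable hB) h.measurable.aestronglyMeasurable hY.aemeasurable] at h1
  exact h1

theorem integral_cost_map (h : IsDualPair ν G T) :
    ∫ y, cost (T y) y ∂ν = ∫ y, (phi G y).toReal ∂ν := by
  refine integral_congr_ae ?_
  filter_upwards [h.ae_isStrictArgmin] with y hy
  exact hy.isArgmin.toReal_phi.symm

theorem integral_phi_le (h : IsDualPair ν G T) {γ : Measure ((ℝ × ℝ) × (ℝ × ℝ))}
    (hγ : γ ∈ martingalePlans ν) : ∫ y, (phi G y).toReal ∂ν ≤ ∫ z, cost z.1 z.2 ∂γ := by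
  obtain ⟨g, hg⟩ := h.isDualMaximizer.1.exists_isParam
  exact hg.integral_phi_le hγ (h.isDualMaximizer.ae_mem_phiDom h.memLp) h.integrable_phi

/-- A plan without duality gap is concentrated on the graph of the minimizer. -/
theorem ae_eq_of_integral_le (h : IsDualPair ν G T) {γ : Measure ((ℝ × ℝ) × (ℝ × ℝ))}
    (hγ : γ ∈ martingalePlans ν) (hle : ∫ z, cost z.1 z.2 ∂γ ≤ ∫ y, (phi G y).toReal ∂ν) :
    ∀ᵐ z ∂γ, z.1 = T z.2 := by
  obtain ⟨g, hg⟩ := h.isDualMaximizer.1.exists_isParam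
  have hstrict : ∀ᵐ y ∂(γ.map Prod.snd), IsStrictArgmin G y (T y) := by
    rw [hγ.2.2.1]; exact h.ae_isStrictArgmin
  filter_upwards [hg.ae_mem_of_integral_le hγ (h.isDualMaximizer.ae_mem_phiDom h.memLp)
    h.integrable_phi hle, ae_of_ae_map measurable_snd.aemeasurable hstrict] with z hz hs
  by_contra hne
  have := hs.2 _ hz.1 hne
  rw [hz.2, hs.isArgmin.toReal_phi] at this
  exact lt_irrefl _ this

theorem eq_map_of_integral_le (h : IsDualPair ν G T) {γ : Measure ((ℝ × ℝ) × (ℝ × ℝ))}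
    (hγ : γ ∈ martingalePlans ν) (hle : ∫ z, cost z.1 z.2 ∂γ ≤ ∫ y, (phi G y).toReal ∂ν) :
    γ = ν.map fun y => (T y, y) := by
  have h1 : (id : (ℝ × ℝ) × (ℝ × ℝ) → (ℝ × ℝ) × (ℝ × ℝ)) =ᵐ[γ] fun z => (T z.2, z.2) := by
    filter_upwards [h.ae_eq_of_integral_le hγ hle] with z hz
    exact Prod.ext hz rfl
  have h2 : γ.map (fun z => (T z.2, z.2)) = (γ.map Prod.snd).map fun y => (T y, y) :=
    (Measure.map_map (h.measurable.prodMk measurable_id) measurable_snd).symm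
  rw [← hγ.2.2.1, ← h2, ← Measure.map_congr h1, Measure.map_id]

end IsDualPair

theorem integral_cost_map_prodMk {Ω : Type*} [MeasurableSpace Ω] {P : Measure Ω}
    {X Y : Ω → ℝ × ℝ} (hX : Measurable X) (hY : Measurable Y) :
    ∫ z, cost z.1 z.2 ∂(P.map fun ω => (X ω, Y ω)) = ∫ ω, cost (X ω) (Y ω) ∂P :=
  integral_map (hX.prodMk hY).aemeasurable measurable_cost.aestronglyMeasurable

end BackwardMOT

theorem theorem5 {Ω : Type*} [MeasurableSpace Ω] (P : Measure Ω) [IsProbabilityMeasure P]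
    (Y : Ω → ℝ × ℝ) (hYmeas : Measurable Y) (hYL2 : MemLp Y 2 P)
    (hYreg : BackwardMOT.IsDRegular (P.map Y))
    (hY1 : NullSingletonClass (P.map fun ω => (Y ω).1))
    (hY2 : NullSingletonClass (P.map fun ω => (Y ω).2))
    (G : Set (ℝ × ℝ)) (hG : BackwardMOT.IsDualMaximizer (P.map Y) G) :
    -- `φ_G` is differentiable at `Y` almost surely
    (∀ᵐ ω ∂P, Y ω ∈ BackwardMOT.gradDom G) ∧
    ∃ X : Ω → ℝ × ℝ,
      -- `X = Dᶜφ_G(Y)` almost surely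
      (∀ᵐ ω ∂P, X ω = BackwardMOT.Dc G (Y ω)) ∧
      -- `X` is an optimal map, and the only one up to null sets
      BackwardMOT.IsOptimalMap P Y X ∧
      (∀ X' : Ω → ℝ × ℝ, BackwardMOT.IsOptimalMap P Y X' → X' =ᵐ[P] X) ∧
      -- the law of `(X, Y)` is the only optimal plan
      BackwardMOT.IsOptimalPlan (P.map Y) (P.map fun ω => (X ω, Y ω)) ∧
      (∀ γ : Measure ((ℝ × ℝ) × (ℝ × ℝ)), BackwardMOT.IsOptimalPlan (P.map Y) γ →
        γ = P.map fun ω => (X ω, Y ω)) ∧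
      -- regularity of the laws of `X`, `X₁`, and `X₂`
      BackwardMOT.IsDRegular (P.map X) ∧
      NullSingletonClass (P.map fun ω => (X ω).1) ∧
      NullSingletonClass (P.map fun ω => (X ω).2) := by
  have hprob : IsProbabilityMeasure (P.map Y) :=
    Measure.isProbabilityMeasure_map hYmeas.aemeasurable
  have hL2 : MemLp id 2 (P.map Y) :=
    (memLp_map_measure_iff aestronglyMeasurable_id hYmeas.aemeasurable).2 hYL2
  have hfst : NullSingletonClass ((P.map Y).map Prod.fst) := by
    rw [Measure.map_map measurable_fst hYmeas]; exact hY1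
  have hsnd : NullSingletonClass ((P.map Y).map Prod.snd) := by
    rw [Measure.map_map measurable_snd hYmeas]; exact hY2
  have h := hG.isDualPair hL2 hYreg
  set T := BackwardMOT.dualMap G
  have hT := h.measurable
  have hatom : ∀ p ∈ G, P.map Y {y | T y = p} = 0 := fun p hp => h.measure_fiber hYreg hp
  have hT1 := h.measure_fst_fiber hatom
  have hT2 := h.measure_snd_fiber hatom
  have hmap := BackwardMOT.IsDualPair.comp_mem_martingaleMaps hYmeas h hT1 hT2
  have hXm : Measurable (T ∘ Y) := hT.comp hYmeas
  have hplan := BackwardMOT.map_mem_martingalePlans hYmeas hYL2 hmap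
  -- The map attains the dual value, so there is no duality gap; optimality is then weak duality,
  -- and uniqueness is complementary slackness.
  have hval : ∫ ω, BackwardMOT.cost ((T ∘ Y) ω) (Y ω) ∂P =
      ∫ y, (BackwardMOT.phi G y).toReal ∂(P.map Y) := by
    rw [← h.integral_cost_map, integral_map hYmeas.aemeasurable]
    · rfl
    · exact (BackwardMOT.measurable_cost.comp (hT.prodMk measurable_id)).aestronglyMeasurable
  have hvalplan := BackwardMOT.integral_cost_map_prodMk (P := P) hXm hYmeas
  have hmapcost : ∀ X' ∈ BackwardMOT.martingaleMaps P Y,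
      ∫ z, BackwardMOT.cost z.1 z.2 ∂(P.map fun ω => (X' ω, Y ω)) =
        ∫ ω, BackwardMOT.cost (X' ω) (Y ω) ∂P := fun X' hX' =>
    BackwardMOT.integral_cost_map_prodMk
      (BackwardMOT.measurable_of_mem_martingaleMaps hYmeas hX') hYmeas
  refine ⟨ae_of_ae_map hYmeas.aemeasurable h.ae_mem_gradDom, T ∘ Y,
    ae_of_ae_map hYmeas.aemeasurable h.ae_eq_Dc, ⟨hmap, fun X' hX' => ?_⟩, fun X' hX' => ?_,
    ⟨hplan, fun γ hγ => ?_⟩, fun γ hγ => ?_, ?_, ⟨fun a => ?_⟩, ⟨fun b => ?_⟩⟩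
  · rw [hval, ← hmapcost X' hX']
    exact h.integral_phi_le (BackwardMOT.map_mem_martingalePlans hYmeas hYL2 hX')
  · have hle := hX'.2 _ hmap
    rw [hval, ← hmapcost X' hX'.1] at hle
    have hae := h.ae_eq_of_integral_le
      (BackwardMOT.map_mem_martingalePlans hYmeas hYL2 hX'.1) hle
    exact ae_of_ae_map ((BackwardMOT.measurable_of_mem_martingaleMaps hYmeas
      hX'.1).prodMk hYmeas).aemeasurable hae
  · rw [hvalplan, hval]
    exact h.integral_phi_le hγ
  · have hle := hγ.2 _ hplan
    rw [hvalplan, hval] at hle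
    rw [h.eq_map_of_integral_le hγ.1 hle]
    exact Measure.map_map (hT.prodMk measurable_id) hYmeas
  · rw [← Measure.map_map hT hYmeas]
    exact h.isDRegular_map hatom
  · rw [Measure.map_apply hXm.fst (measurableSet_singleton a)]
    exact (Measure.map_apply hYmeas (hT.fst (measurableSet_singleton a))).symm.trans (hT1 a)
  · rw [Measure.map_apply hXm.snd (measurableSet_singleton b)]
    exact (Measure.map_apply hYmeas (hT.snd (measurableSet_singleton b))).symm.trans (hT2 b)
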